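/- Let $\Omega\subset\mathbb R^2$ be a bounded polygonal domain, and let $\mathcal T_0,\dots,\mathcal T_L$ be nested conforming triangulations of $\overline\Omega$ (every triangle of $\mathcal T_{l+1}$ lies in a triangle of $\mathcal T_l$) with edge sets $\mathcal E_l$ and mesh sizes $h_l=\max_{T\in\mathcal T_l}h_T$, $h_T=\operatorname{diam}T$. Assume that they are shape regular and quasi-uniform with constants $\sigma,\rho$: for all $l$ and all $T\in\mathcal T_l$, $T$ contains a disc of diameter at least $h_T/\sigma$, and $h_l\le\rho\,h_T$. Let the stabilization parameter $\tau_l$ be constant on each $T\in\mathcal T_l$ with $0<\tau_l|_T\le c_\tau h_l^{-1}$. Let $P_1(S)$ be the real polynomials of degree at most one on $S$, and $$M_l=\{\mu\in L^2(\mathcal E_l):\ \mu|_e\in P_1(e)\ \ \forall e\in\mathcal E_l\},\qquad M_l^0=\{\mu\in M_l:\ \mu|_{\partial\Omega}=0\}.$$ For $\mu\in M_l$ and $T\in\mathcal T_l$ let $(Q_\mu,U_\mu)\in P_1(T)^2\times P_1(T)$ be the solution of the local HDG problem for the Poisson equation $$(Q_\mu,v)_T-(U_\mu,\operatorname{div}v)_T=-\langle\mu,v\cdot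 n\rangle_{\partial T}\quad\forall v\in P_1(T)^2,$$ $$-(Q_\mu,\nabla w)_T+\langle Q_\mu\cdot n+\tau_l(U_\mu-\mu),w\rangle_{\partial T}=0\quad\forall w\in P_1(T),$$ where $n$ is the outward unit normal and $(\cdot,\cdot)_T$, $\langle\cdot,\cdot\rangle_{\partial T}$ are the $L^2$ inner products, and set $$\hat a_l(\lambda,\mu)=\sum_{T\in\mathcal T_l}\Big((Q_\lambda,Q_\mu)_T+\tau_l|_T\,\langle U_\lambda-\lambda,U_\mu-\mu\rangle_{\partial T}\Big).$$ For $\mu\in M_l$ let $I_l^W\mu$ be the continuous function on $\overline\Omega$, affine on each triangle of $\mathcal T_l$, whose value at each vertex $z$ of $\mathcal T_l$ is the arithmetic mean of the values $\mu|_e(z)$ over all edges $e\in\mathcal E_l$ containing $z$. Let $I_l\mu=(I_l^W\mu)|_{\mathcal E_L}$ for $0\le l\le L-1$, and let $I_L$ be the identity. Theorem. The local problems are uniquely solvable, $I_l$ maps $M_l$ into $M_L$, and there is a constant $C>0$ that depends only on $\sigma,\rho,c_\tau$ (in particular, neither on the mesh sizes nor on the levels $l$ and $L$) such that for all $0\le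 l\le L$ $$\hat a_L(I_l\mu,I_l\mu)\le C\,\hat a_l(\mu,\mu)\qquad\forall\,\mu\in M_l^0.$$ -/

import Mathlib

noncomputable section

open MeasureTheory
open scoped RealInnerProductSpace

namespace HDG

/-- The Euclidean plane `ℝ²`. -/
abbrev Plane := EuclideanSpace ℝ (Fin 2)

/-! ### Triangulations -/

/-- A conforming triangulation of `closure Ω`: a finite geometric simplicial complex of the plane,
every face of which is a face of a triangle, with underlying space `closure Ω`.
A triangle, an edge or a vertex is recorded by its finite set of vertices (three, two, one of
them); the closed point set is the convex hull. -/
structure Triangulation (Ω : Set Plane) where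
  /-- the underlying geometric simplicial complex -/
  complex : Geometry.SimplicialComplex ℝ Plane
  finite : complex.faces.Finite
  pure : ∀ s ∈ complex.faces, ∃ T ∈ complex.faces, s ⊆ T ∧ T.card = 3
  cover : complex.space = closure Ω

/-- The closed triangle or segment with the given vertices. -/
def hull (s : Finset Plane) : Set Plane := convexHull ℝ (s : Set Plane)

/-- The three edges of a triangle. -/
def triangleEdges (T : Finset Plane) : Finset (Finset Plane) := T.powersetCard 2

namespace Triangulation

variable {Ω : Set Plane}

/-- The triangles of the mesh. -/
def triangles (𝒯 : Triangulation Ω) : Finset (Finset Plane) :=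
  𝒯.finite.toFinset.filter fun s => s.card = 3

/-- The edges of the mesh. -/
def edges (𝒯 : Triangulation Ω) : Finset (Finset Plane) :=
  𝒯.finite.toFinset.filter fun s => s.card = 2

open scoped Classical in
/-- The edges that contain the point `z` as an endpoint. -/
def edgesAt (𝒯 : Triangulation Ω) (z : Plane) : Finset (Finset Plane) :=
  𝒯.edges.filter fun e => z ∈ e

/-- The mesh size, the largest diameter of a triangle. -/
def meshSize (𝒯 : Triangulation Ω) : ℝ :=
  sSup ((fun T => Metric.diam (hull T)) '' (𝒯.triangles : Set (Finset Plane)))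

/-- Shape regularity with constant `σ`: every triangle `T` contains a disc whose diameter is at
least `diam T / σ`. -/
def ShapeRegular (𝒯 : Triangulation Ω) (σ : ℝ) : Prop :=
  ∀ T ∈ 𝒯.triangles, ∃ x : Plane, ∃ r : ℝ, 0 < r ∧ Metric.closedBall x r ⊆ hull T ∧
    Metric.diam (hull T) ≤ σ * (2 * r)

/-- Quasi-uniformity with constant `ρ`: all triangles have a diameter comparable with the
mesh size. -/
def QuasiUniform (𝒯 : Triangulation Ω) (ρ : ℝ) : Prop :=
  ∀ T ∈ 𝒯.triangles, 𝒯.meshSize ≤ ρ * Metric.diam (hull T)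

/-- `𝒯'` is a refinement of `𝒯`: every triangle of `𝒯'` lies in a triangle of `𝒯`. -/
def IsRefinement (𝒯' 𝒯 : Triangulation Ω) : Prop :=
  ∀ T' ∈ 𝒯'.triangles, ∃ T ∈ 𝒯.triangles, hull T' ⊆ hull T

end Triangulation

/-! ### Local spaces, integrals and the outward normal

Polynomials of degree at most one on a triangle are (restrictions of) affine functions on the
plane, and affine functions are determined by their restriction to a triangle. -/

/-- `W(T)`, the scalar polynomials of degree at most one. -/
abbrev ScalarP1 := Plane →ᵃ[ℝ] ℝ

/-- `V(T)`, the vector fields both components of which are polynomials of degree at most one. -/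
abbrev VectorP1 := Plane →ᵃ[ℝ] Plane

/-- The (constant) divergence of an affine vector field: the trace of its derivative. -/
def divergence (v : VectorP1) : ℝ := LinearMap.trace ℝ Plane v.linear

/-- The integral over a closed triangle with respect to the area. -/
def triangleIntegral (T : Finset Plane) (f : Plane → ℝ) : ℝ := ∫ x in hull T, f x

/-- The integral over a closed edge with respect to the arc length. -/
def edgeIntegral (e : Finset Plane) (f : Plane → ℝ) : ℝ :=
  ∫ x in hull e, f x ∂(Measure.hausdorffMeasure 1 : Measure Plane)

/-- The integral over the boundary of `T` of a function that is given edge by edge. -/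
def boundaryIntegral (T : Finset Plane) (f : Finset Plane → Plane → ℝ) : ℝ :=
  ∑ e ∈ triangleEdges T, edgeIntegral e (f e)

/-- `n` is the unit normal on the edge `e` of the triangle `T` that points out of `T`. -/
structure IsOutwardNormal (T e : Finset Plane) (n : Plane) : Prop where
  norm_eq_one : ‖n‖ = 1
  orthogonal : ∀ a ∈ e, ∀ b ∈ e, ⟪n, b - a⟫ = 0
  outward : ∀ a ∈ e, ∀ c ∈ T, c ∉ e → ⟪n, c - a⟫ < 0

/-- An edge of a nondegenerate triangle has an outward unit normal. -/
theorem exists_isOutwardNormal {T e : Finset Plane} (hT : T.card = 3)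
    (hind : AffineIndependent ℝ ((↑) : T → Plane)) (he : e ∈ triangleEdges T) :
    ∃ n, IsOutwardNormal T e n := by
  classical
  obtain ⟨heT, hec⟩ := Finset.mem_powersetCard.1 he
  obtain ⟨a, b, hab, rfl⟩ := Finset.card_eq_two.1 hec
  have hcard : (T \ {a, b}).card = 1 := by rw [Finset.card_sdiff_of_subset heT, hT, hec]
  obtain ⟨c, hc⟩ := Finset.card_eq_one.1 hcard
  have hcm : c ∈ T \ {a, b} := by rw [hc]; simp
  have hcT : c ∈ T := (Finset.mem_sdiff.1 hcm).1
  have hcab : c ∉ ({a, b} : Finset Plane) := (Finset.mem_sdiff.1 hcm).2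
  have haT : a ∈ T := heT (by simp)
  have hbT : b ∈ T := heT (by simp)
  have hu : b - a ≠ 0 := sub_ne_zero.2 (Ne.symm hab)
  have huu : ⟪b - a, b - a⟫ ≠ 0 := by simpa [inner_self_eq_zero] using hu
  set t : ℝ := ⟪b - a, c - a⟫ / ⟪b - a, b - a⟫ with ht
  set w : Plane := (c - a) - t • (b - a) with hw
  have hwu : ⟪w, b - a⟫ = 0 := by
    rw [hw, inner_sub_left, inner_smul_left, real_inner_comm (b - a) (c - a)]
    simp only [conj_trivial, ht]
    field_simp
    ring
  have hw0 : w ≠ 0 := by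
    intro h0
    have hline : c ∈ affineSpan ℝ (({a, b} : Set Plane)) := by
      have : c = AffineMap.lineMap a b t := by
        rw [AffineMap.lineMap_apply_module']
        have : c - a = t • (b - a) := sub_eq_zero.1 (by rw [← hw]; exact h0)
        rw [← this]; abel
      rw [this]
      exact AffineMap.lineMap_mem_affineSpan_pair _ _ _
    have key := hind.notMem_affineSpan_sdiff ⟨c, hcT⟩ (Set.univ)
    apply key
    refine affineSpan_mono ℝ ?_ hline
    rintro x (rfl | rfl)
    · exact ⟨⟨x, haT⟩, ⟨trivial, fun h => hcab (by
        have : x = c := congrArg Subtype.val h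
        simp [← this])⟩, rfl⟩
    · exact ⟨⟨x, hbT⟩, ⟨trivial, fun h => hcab (by
        have : x = c := congrArg Subtype.val h
        simp [← this])⟩, rfl⟩
  have hwpos : 0 < ‖w‖ := norm_pos_iff.2 hw0
  have hwc : ⟪w, c - a⟫ = ‖w‖ ^ 2 := by
    have : c - a = w + t • (b - a) := by rw [hw]; abel
    rw [this, inner_add_right, inner_smul_right, hwu, real_inner_self_eq_norm_sq]
    ring
  refine ⟨(-‖w‖⁻¹) • w, ?_, ?_, ?_⟩
  · rw [norm_smul, norm_neg, norm_inv, norm_norm]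
    exact inv_mul_cancel₀ hwpos.ne'
  · intro x hx y hy
    rw [inner_smul_left]
    have hwu' : ⟪w, a - b⟫ = 0 := by rw [← neg_sub, inner_neg_right, hwu, neg_zero]
    simp only [Finset.mem_insert, Finset.mem_singleton] at hx hy
    rcases hx with rfl | rfl <;> rcases hy with rfl | rfl <;> simp [hwu, hwu']
  · intro x hx y hy hye
    have hyc : y = c := by
      have : y ∈ T \ {a, b} := Finset.mem_sdiff.2 ⟨hy, hye⟩
      rw [hc] at this
      simpa using this
    subst hyc
    have hwx : ⟪w, y - x⟫ = ‖w‖ ^ 2 := by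
      simp only [Finset.mem_insert, Finset.mem_singleton] at hx
      rcases hx with rfl | rfl
      · exact hwc
      · have : y - x = (y - a) - (x - a) := by abel
        rw [this, inner_sub_right, hwc, hwu, sub_zero]
    rw [inner_smul_left, hwx]
    simp only [conj_trivial]
    have := inv_pos.2 hwpos
    have h2 : 0 < ‖w‖ ^ 2 := by positivity
    nlinarith [mul_pos this h2]

open scoped Classical in
/-- The outward unit normal of the triangle `T` on its edge `e`. -/
def outwardNormal (T e : Finset Plane) : Plane :=
  if h : ∃ n, IsOutwardNormal T e n then h.choose else 0

/-! ### Traces on the skeleton -/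

/-- The space `M` of a mesh: functions on the union of the edges, given edge by edge and in general
two-valued or multivalued at vertices, that are polynomials of degree at most one on each edge.
Here `μ e x` is the value at the point `x` of the edge `e`; the values of `μ e` off the edge `e`
and of `μ e` for sets `e` that are not edges play no role. -/
def traceSpace {Ω : Set Plane} (𝒯 : Triangulation Ω) : Set (Finset Plane → Plane → ℝ) :=
  {μ | ∀ e ∈ 𝒯.edges, ∃ p : ScalarP1, ∀ x ∈ hull e, μ e x = p x}

/-- The subspace `M⁰` of the functions that vanish on the edges contained in `∂Ω`. -/
def traceSpaceZero {Ω : Set Plane} (𝒯 : Triangulation Ω) : Set (Finset Plane → Plane → ℝ) :=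
  {μ | μ ∈ traceSpace 𝒯 ∧ ∀ e ∈ 𝒯.edges, hull e ⊆ frontier Ω → ∀ x ∈ hull e, μ e x = 0}

/-! ### The local HDG solver and the hybridized energy form -/

/-- `(Q, U) = s` solves the local problem on the triangle `T` with stabilization parameter `τ` and
boundary datum `m`:
`(Q, v)_T - (U, div v)_T = -⟨m, v · n⟩_{∂T}` for all `v ∈ V(T)`, and
`-(Q, ∇w)_T + ⟨Q · n + τ (U - m), w⟩_{∂T} = 0` for all `w ∈ W(T)`. -/
structure IsLocalSolution (τ : ℝ) (T : Finset Plane) (m : Finset Plane → Plane → ℝ)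
    (s : VectorP1 × ScalarP1) : Prop where
  flux : ∀ v : VectorP1,
    triangleIntegral T (fun x => ⟪s.1 x, v x⟫) - triangleIntegral T (fun x => s.2 x * divergence v)
      = -boundaryIntegral T (fun e x => m e x * ⟪v x, outwardNormal T e⟫)
  conservation : ∀ w : ScalarP1,
    -triangleIntegral T (fun x => ⟪s.1 x, gradient (fun y => w y) x⟫)
      + boundaryIntegral T
          (fun e x => (⟪s.1 x, outwardNormal T e⟫ + τ * (s.2 x - m e x)) * w x) = 0

open scoped Classical in
/-- The solution `(Q_m, U_m)` of the local problem on `T`. -/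
def localSolution (τ : ℝ) (T : Finset Plane) (m : Finset Plane → Plane → ℝ) :
    VectorP1 × ScalarP1 :=
  if h : ∃ s, IsLocalSolution τ T m s then h.choose else 0

/-- The hybridized form
`â(λ, μ) = ∑_T ((Q_λ, Q_μ)_T + τ_T ⟨U_λ - λ, U_μ - μ⟩_{∂T})`. -/
def energyForm {Ω : Set Plane} (𝒯 : Triangulation Ω) (τ : Finset Plane → ℝ)
    (lam μ : Finset Plane → Plane → ℝ) : ℝ :=
  ∑ T ∈ 𝒯.triangles,
    (triangleIntegral T
        (fun x => ⟪(localSolution (τ T) T lam).1 x, (localSolution (τ T) T μ).1 x⟫)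
      + τ T * boundaryIntegral T (fun e x =>
          ((localSolution (τ T) T lam).2 x - lam e x) * ((localSolution (τ T) T μ).2 x - μ e x)))

/-! ### The intergrid transfer operator -/

/-- Values at the vertices of a nondegenerate triangle are interpolated by an affine function. -/
theorem exists_interpolant {T : Finset Plane} (hT : T.card = 3)
    (hind : AffineIndependent ℝ ((↑) : T → Plane)) (g : Plane → ℝ) :
    ∃ p : ScalarP1, ∀ z ∈ T, p z = g z := by
  classical
  have htop : affineSpan ℝ (Set.range ((↑) : T → Plane)) = ⊤ := by
    rw [hind.affineSpan_eq_top_iff_card_eq_finrank_add_one]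
    simp [hT]
  let b : AffineBasis T ℝ Plane := ⟨(↑), hind, htop⟩
  refine ⟨∑ i : T, g i • b.coord i, fun z hz => ?_⟩
  have hbz : (b ⟨z, hz⟩ : Plane) = z := rfl
  have hsum : ∀ s : Finset T, (∑ i ∈ s, g i • b.coord i : ScalarP1) z
      = ∑ i ∈ s, g i * b.coord i z := by
    intro s
    induction s using Finset.induction_on with
    | empty => simp
    | insert i s his ih =>
      rw [Finset.sum_insert his, Finset.sum_insert his, ← ih]
      simp
  rw [hsum, Finset.sum_eq_single ⟨z, hz⟩]
  · have h1 : b.coord ⟨z, hz⟩ z = 1 := by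
      have h := b.coord_apply_eq ⟨z, hz⟩
      rwa [hbz] at h
    rw [h1, mul_one]
  · intro i _ hi
    have h0 : b.coord i z = 0 := by
      have h := b.coord_apply_ne hi
      rwa [hbz] at h
    rw [h0, mul_zero]
  · simp

open scoped Classical in
/-- The affine function with the values `g z` at the vertices `z` of the triangle `T`. -/
def interpolant (T : Finset Plane) (g : Plane → ℝ) : ScalarP1 :=
  if h : ∃ p : ScalarP1, ∀ z ∈ T, p z = g z then h.choose else 0

/-- The average at the vertex `z` of the values of `μ` on the edges that meet in `z`. -/
def vertexAverage {Ω : Set Plane} (𝒯 : Triangulation Ω) (μ : Finset Plane → Plane → ℝ)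
    (z : Plane) : ℝ :=
  (∑ e ∈ 𝒯.edgesAt z, μ e z) / ((𝒯.edgesAt z).card : ℝ)

open scoped Classical in
/-- The operator `I^W`: the continuous piecewise linear function on `closure Ω` whose value at each
vertex is the average of `μ` over the edges that meet there.  On a triangle containing `x` it is
the affine interpolant of the vertex averages; as the mesh is conforming, triangles that share `x`
give the same value. -/
def averageInterpolant {Ω : Set Plane} (𝒯 : Triangulation Ω) (μ : Finset Plane → Plane → ℝ)
    (x : Plane) : ℝ :=
  if h : ∃ T ∈ 𝒯.triangles, x ∈ hull T then interpolant h.choose (vertexAverage 𝒯 μ) x else 0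

/-- The value of `averageInterpolant` does not depend on the triangle chosen: on every triangle it
is the affine interpolant of the vertex averages. -/
theorem averageInterpolant_eq {Ω : Set Plane} (𝒯 : Triangulation Ω)
    (μ : Finset Plane → Plane → ℝ) {T : Finset Plane} (hT : T ∈ 𝒯.triangles) {x : Plane}
    (hx : x ∈ hull T) :
    averageInterpolant 𝒯 μ x = interpolant T (vertexAverage 𝒯 μ) x := by
  have hmem : ∀ S ∈ 𝒯.triangles, S ∈ 𝒯.complex.faces ∧ S.card = 3 := by
    intro S hS
    simpa [Triangulation.triangles] using hS
  have hval : ∀ S ∈ 𝒯.triangles, ∀ z ∈ S,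
      interpolant S (vertexAverage 𝒯 μ) z = vertexAverage 𝒯 μ z := by
    intro S hS
    have h := exists_interpolant (hmem S hS).2 (𝒯.complex.indep (hmem S hS).1) (vertexAverage 𝒯 μ)
    rw [interpolant, dif_pos h]
    exact h.choose_spec
  have h : ∃ S ∈ 𝒯.triangles, x ∈ hull S := ⟨T, hT, hx⟩
  rw [averageInterpolant, dif_pos h]
  obtain ⟨hS, hxS⟩ := h.choose_spec
  set S := h.choose
  have hxi := 𝒯.complex.inter_subset_convexHull (hmem S hS).1 (hmem T hT).1 ⟨hxS, hx⟩
  set p := interpolant S (vertexAverage 𝒯 μ)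
  set q := interpolant T (vertexAverage 𝒯 μ)
  have hconv : Convex ℝ {y : Plane | p y = q y} := by
    intro y hy z hz a b _ _ hab
    have hy' : p y = q y := hy
    have hz' : p z = q z := hz
    change p (a • y + b • z) = q (a • y + b • z)
    rw [Convex.combo_affine_apply hab, Convex.combo_affine_apply hab, hy', hz']
  refine convexHull_min ?_ hconv hxi
  rintro z ⟨hzS, hzT⟩
  change p z = q z
  rw [hval S hS z hzS, hval T hT z hzT]

/-- The intergrid transfer operator `I_l : M_l → M_L`: the restriction of the averaged continuous
piecewise linear function to the edges of the finest mesh if `l < L`, and the identity if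
`l = L`. -/
def transfer {Ω : Set Plane} {L : ℕ} (𝒯 : Fin (L + 1) → Triangulation Ω) (l : Fin (L + 1))
    (μ : Finset Plane → Plane → ℝ) : Finset Plane → Plane → ℝ :=
  if l = Fin.last L then μ else fun _ x => averageInterpolant (𝒯 l) μ x

end HDG

end

/-!
On a triangle of the finest mesh the transferred function `I_l μ` (with `l < L`) is the trace of an
affine function `u`, and the local solution for such a trace is exactly `(-∇u, u)`
(`localSolution_affine`). Hence the fine energy of `I_l μ` is the Dirichlet energy of the
continuous piecewise linear function `I_l^W μ`, which can be computed on the coarse mesh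
(`energyForm_le_dirichlet`), and it remains to bound this Dirichlet energy by the coarse energy of
`μ` (`sum_dirichlet_le`).

On a shape regular triangle the Dirichlet energy of an affine function is bounded by the squared
differences of its vertex values. These are averages of edge values of `μ`, so that two quantities
have to be estimated: the variation of `μ` along an edge, and the difference of the values of `μ` at
a vertex on two edges that meet there.

* Within one triangle both are bounded by the `L²` norm of the flux `Q_μ` alone, uniformly in the
  stabilization parameter. Testing the flux equation with a divergence free affine field `v` leaves
  `(Q_μ, v)_T = -⟨μ, v · n⟩_{∂T}`. For a vertex `z` of the triangle `z, a, b` and its barycentric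
  coordinate `λ`, the field `(1 - 3 λ) (b - a)` makes the right hand side a multiple of the jump of
  `μ` at `z`, and the constant field `b - a` makes it a multiple of a difference of mean values on
  edges (`sq_test_le_fluxEnergy`).
* Two edges at a vertex `z` that are joined by a chain of triangles at `z` are compared along the
  chain, whose length is bounded by shape regularity and quasi-uniformity. If no such chain exists,
  both edges are joined to an edge in `∂Ω`, where `μ` vanishes (`reachable_or_exists_frontier`): if
  no frontier edge is met, the cones spanned at `z` by the triangles of the chain component form a
  set that is open and closed in the punctured plane, and therefore all of it.

The local problem is uniquely solvable because it is a square linear system, and on the diagonal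
its bilinear form is `‖Q‖²_T + τ ‖U‖²_{∂T}` by integration by parts (`localForm_self`). The
integrals are evaluated exactly: over edges by arc length, over triangles by an affine change of
variables.
-/

open MeasureTheory
open scoped RealInnerProductSpace

namespace HDG

/-! ### Plane geometry of triangles and integrals over them -/

/-- The signed area of the parallelogram spanned by two vectors of the plane. -/
def cross (u v : Plane) : ℝ := u 0 * v 1 - u 1 * v 0

/-- The reference triangle with vertices `(0, 0)`, `(1, 0)`, `(0, 1)`. -/
def refTriangle : Set (ℝ × ℝ) := {p | 0 ≤ p.1 ∧ 0 ≤ p.2 ∧ p.1 + p.2 ≤ 1}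

theorem hull_pair (a b : Plane) : hull {a, b} = segment ℝ a b := by
  simp [hull, convexHull_pair]

theorem mem_hull_pair {a b x : Plane} :
    x ∈ hull {a, b} ↔ ∃ t : ℝ, 0 ≤ t ∧ t ≤ 1 ∧ x = a + t • (b - a) := by
  rw [hull_pair, segment_eq_image']
  constructor
  · rintro ⟨t, ht, rfl⟩
    exact ⟨t, ht.1, ht.2, rfl⟩
  · rintro ⟨t, h0, h1, rfl⟩
    exact ⟨t, ⟨h0, h1⟩, rfl⟩

theorem mem_hull_triple {z a b x : Plane} :
    x ∈ hull {z, a, b} ↔ ∃ s t : ℝ, 0 ≤ s ∧ 0 ≤ t ∧ s + t ≤ 1 ∧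
      x = z + s • (a - z) + t • (b - z) := by
  have h : ((({z, a, b} : Finset Plane) : Set Plane)) = {z, a, b} := by simp
  rw [hull, h, convexHull_insert ⟨a, by simp⟩, convexHull_pair, mem_convexJoin]
  constructor
  · rintro ⟨z', hz', y, hy, hx⟩
    rw [Set.mem_singleton_iff] at hz'
    subst hz'
    obtain ⟨α, β, hα, hβ, hαβ, rfl⟩ := hy
    obtain ⟨γ, δ, hγ, hδ, hγδ, rfl⟩ := hx
    refine ⟨δ * α, δ * β, by positivity, by positivity, ?_, ?_⟩
    · rw [← mul_add, hαβ]; linarith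
    · obtain rfl : α = 1 - β := by linarith
      obtain rfl : γ = 1 - δ := by linarith
      module
  · rintro ⟨s, t, hs, ht, hst, rfl⟩
    refine ⟨z, rfl, ?_⟩
    rcases eq_or_lt_of_le (add_nonneg hs ht) with h0 | h0
    · obtain rfl : s = 0 := by linarith
      obtain rfl : t = 0 := by linarith
      exact ⟨a, left_mem_segment ℝ a b, by simp [left_mem_segment]⟩
    · refine ⟨(s / (s + t)) • a + (t / (s + t)) • b,
        ⟨s / (s + t), t / (s + t), by positivity, by positivity, by field_simp, rfl⟩,
        1 - (s + t), s + t, by linarith, h0.le, by ring, ?_⟩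
      rw [smul_add, smul_smul, smul_smul, mul_div_cancel₀ _ h0.ne', mul_div_cancel₀ _ h0.ne']
      module

theorem measurableSet_refTriangle : MeasurableSet refTriangle := by
  apply IsClosed.measurableSet
  exact (isClosed_le continuous_const continuous_fst).inter
    ((isClosed_le continuous_const continuous_snd).inter
      (isClosed_le (continuous_fst.add continuous_snd) continuous_const))

theorem isCompact_refTriangle : IsCompact refTriangle := by
  refine (isCompact_Icc.prod isCompact_Icc :
    IsCompact (Set.Icc (0 : ℝ) 1 ×ˢ Set.Icc (0 : ℝ) 1)).of_isClosed_subset ?_ ?_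
  · exact (isClosed_le continuous_const continuous_fst).inter
      ((isClosed_le continuous_const continuous_snd).inter
        (isClosed_le (continuous_fst.add continuous_snd) continuous_const))
  · rintro ⟨x, y⟩ ⟨h1, h2, h3⟩
    simp only at h1 h2 h3
    exact ⟨⟨h1, by simp only; linarith⟩, ⟨h2, by simp only; linarith⟩⟩

theorem integral_quadratic (c₀ c₁ c₂ r : ℝ) :
    ∫ t in (0 : ℝ)..r, (c₀ + c₁ * t + c₂ * t ^ 2) = c₀ * r + c₁ * r ^ 2 / 2 + c₂ * r ^ 3 / 3 := by
  have h : ∀ t : ℝ, HasDerivAt (fun t : ℝ => c₀ * t + c₁ * t ^ 2 / 2 + c₂ * t ^ 3 / 3)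
      (c₀ + c₁ * t + c₂ * t ^ 2) t := by
    intro t
    have h1 := (hasDerivAt_id t).const_mul c₀
    have h2 := ((hasDerivAt_pow 2 t).const_mul c₁).div_const 2
    have h3 := ((hasDerivAt_pow 3 t).const_mul c₂).div_const 3
    refine ((h1.add h2).add h3).congr_deriv ?_
    norm_num
    ring
  rw [intervalIntegral.integral_eq_sub_of_hasDerivAt (fun t _ => h t)
    (Continuous.intervalIntegrable (by fun_prop) _ _)]
  ring

theorem setIntegral_refTriangle_affine (c₀ c₁ c₂ : ℝ) :
    ∫ p in refTriangle, (c₀ + c₁ * p.1 + c₂ * p.2) = c₀ / 2 + c₁ / 6 + c₂ / 6 := by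
  have hint : IntegrableOn (fun p : ℝ × ℝ => c₀ + c₁ * p.1 + c₂ * p.2) refTriangle :=
    (Continuous.continuousOn (by fun_prop)).integrableOn_compact isCompact_refTriangle
  rw [← integral_indicator measurableSet_refTriangle, Measure.volume_eq_prod, integral_prod]
  swap
  · rw [← Measure.volume_eq_prod]
    exact hint.integrable_indicator measurableSet_refTriangle
  have hinner : ∀ x : ℝ, ∫ y, refTriangle.indicator (fun p : ℝ × ℝ => c₀ + c₁ * p.1 + c₂ * p.2)
      (x, y) = (Set.Icc (0 : ℝ) 1).indicator
        (fun x => (c₀ + c₁ * x) * (1 - x) + c₂ * ((1 - x) ^ 2 / 2)) x := by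
    intro x
    by_cases hx : x ∈ Set.Icc (0 : ℝ) 1
    · rw [Set.indicator_of_mem hx]
      have : (fun y => refTriangle.indicator (fun p : ℝ × ℝ => c₀ + c₁ * p.1 + c₂ * p.2) (x, y))
          = (Set.Icc 0 (1 - x)).indicator (fun y => (c₀ + c₁ * x) + c₂ * y) := by
        funext y
        by_cases hy : y ∈ Set.Icc 0 (1 - x)
        · rw [Set.indicator_of_mem hy, Set.indicator_of_mem]
          exact ⟨hx.1, hy.1, by simp only; linarith [hy.2]⟩
        · rw [Set.indicator_of_notMem hy, Set.indicator_of_notMem]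
          rintro ⟨h1, h2, h3⟩
          simp only at h1 h2 h3
          exact hy ⟨h2, by linarith⟩
      rw [this, integral_indicator measurableSet_Icc, integral_Icc_eq_integral_Ioc,
        ← intervalIntegral.integral_of_le (by linarith [hx.2])]
      have h := integral_quadratic (c₀ + c₁ * x) c₂ 0 (1 - x)
      simp only [zero_mul, add_zero] at h
      rw [h]
      ring
    · rw [Set.indicator_of_notMem hx]
      refine integral_eq_zero_of_ae (Filter.Eventually.of_forall fun y => ?_)
      simp only [Pi.zero_apply]
      apply Set.indicator_of_notMem
      rintro ⟨h1, h2, h3⟩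
      simp only at h1 h2 h3
      exact hx ⟨h1, by linarith⟩
  simp_rw [hinner]
  rw [integral_indicator measurableSet_Icc, integral_Icc_eq_integral_Ioc,
    ← intervalIntegral.integral_of_le zero_le_one]
  have : (fun x : ℝ => (c₀ + c₁ * x) * (1 - x) + c₂ * ((1 - x) ^ 2 / 2)) =
      fun x => (c₀ + c₂ / 2) + (c₁ - c₀ - c₂) * x + (c₂ / 2 - c₁) * x ^ 2 := by
    funext x; ring
  rw [this, integral_quadratic]
  ring

/-- The volume preserving coordinates of the plane. -/
def planeCoord : ℝ × ℝ ≃ᵐ Plane :=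
  (MeasurableEquiv.finTwoArrow (α := ℝ)).symm.trans (MeasurableEquiv.toLp 2 (Fin 2 → ℝ))

theorem measurePreserving_planeCoord : MeasurePreserving planeCoord volume volume :=
  ((volume_preserving_finTwoArrow ℝ).symm _).trans (PiLp.volume_preserving_toLp (Fin 2))

theorem planeCoord_apply (p : ℝ × ℝ) : planeCoord p = !₂[p.1, p.2] := by
  rfl

/-- The affine change of variables to the reference triangle. -/
theorem setIntegral_hull_triple (z a b : Plane) (h : cross (a - z) (b - z) ≠ 0) (f : Plane → ℝ) :
    ∫ x in hull {z, a, b}, f x = |cross (a - z) (b - z)| *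
      ∫ p in refTriangle, f (z + p.1 • (a - z) + p.2 • (b - z)) := by
  have hpre : ∫ x in hull {z, a, b}, f x
      = ∫ p in planeCoord ⁻¹' (hull {z, a, b}), f (planeCoord p) :=
    (measurePreserving_planeCoord.setIntegral_preimage_emb
      planeCoord.measurableEmbedding f _).symm
  let M : Matrix (Fin 2) (Fin 2) ℝ := !![a 0 - z 0, b 0 - z 0; a 1 - z 1, b 1 - z 1]
  let A : ℝ × ℝ →L[ℝ] ℝ × ℝ :=
    LinearMap.toContinuousLinearMap (Matrix.toLin (Module.Basis.finTwoProd ℝ)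
      (Module.Basis.finTwoProd ℝ) M)
  have hA : ∀ p, A p = ((a 0 - z 0) * p.1 + (b 0 - z 0) * p.2,
      (a 1 - z 1) * p.1 + (b 1 - z 1) * p.2) := by
    intro p
    simp [A, M, Matrix.toLin_finTwoProd_apply]
  have hdet : A.det = cross (a - z) (b - z) := by
    simp [A, M, LinearMap.det_toContinuousLinearMap, LinearMap.det_toLin, Matrix.det_fin_two,
      cross]
    ring
  let φ : ℝ × ℝ → ℝ × ℝ := fun p => (z 0, z 1) + A p
  have hφ : ∀ p, planeCoord (φ p) = z + p.1 • (a - z) + p.2 • (b - z) := by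
    intro p
    rw [planeCoord_apply]
    ext i
    fin_cases i <;> simp [φ, hA] <;> ring
  have himg : planeCoord ⁻¹' (hull {z, a, b}) = φ '' refTriangle := by
    ext q
    rw [Set.mem_preimage, mem_hull_triple]
    constructor
    · rintro ⟨s, t, hs, ht, hst, hq⟩
      refine ⟨(s, t), ⟨hs, ht, hst⟩, ?_⟩
      apply planeCoord.injective
      rw [hφ, hq]
    · rintro ⟨p, ⟨h1, h2, h3⟩, rfl⟩
      exact ⟨p.1, p.2, h1, h2, h3, hφ p⟩
  have hinj : Function.Injective φ := by
    intro p q hpq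
    have h1 : A p = A q := by simpa [φ] using hpq
    rw [hA, hA, Prod.mk.injEq] at h1
    obtain ⟨e1, e2⟩ := h1
    simp only [cross, PiLp.sub_apply] at h
    ext
    · apply mul_left_cancel₀ h
      linear_combination (b 1 - z 1) * e1 - (b 0 - z 0) * e2
    · apply mul_left_cancel₀ h
      linear_combination (a 0 - z 0) * e2 - (a 1 - z 1) * e1
  rw [hpre, himg, integral_image_eq_integral_abs_det_fderiv_smul volume measurableSet_refTriangle
    (f' := fun _ => A) (fun x _ => ((A.hasFDerivAt).const_add _).hasFDerivWithinAt) hinj.injOn]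
  simp only [hdet, smul_eq_mul, ← hφ]
  rw [integral_const_mul]

/-- The vertex rule: the integral of an affine function is the area, half the cross product, times
the mean of its vertex values. -/
theorem triangleIntegral_affine (z a b : Plane) (h : cross (a - z) (b - z) ≠ 0) (p : ScalarP1) :
    triangleIntegral {z, a, b} (fun x => p x)
      = |cross (a - z) (b - z)| / 6 * (p z + p a + p b) := by
  rw [triangleIntegral, setIntegral_hull_triple z a b h]
  have : ∀ q : ℝ × ℝ, p (z + q.1 • (a - z) + q.2 • (b - z))
      = p z + (p a - p z) * q.1 + (p b - p z) * q.2 := by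
    intro q
    have e : z + q.1 • (a - z) + q.2 • (b - z)
        = (q.1 • (a -ᵥ z) + q.2 • (b -ᵥ z)) +ᵥ z := by
      simp only [vsub_eq_sub, vadd_eq_add]; abel
    rw [e, AffineMap.map_vadd, map_add, map_smul, map_smul, AffineMap.linearMap_vsub,
      AffineMap.linearMap_vsub]
    simp only [vsub_eq_sub, vadd_eq_add, smul_eq_mul]
    ring
  simp_rw [this]
  rw [setIntegral_refTriangle_affine]
  ring

theorem isCompact_hull (s : Finset Plane) : IsCompact (hull s) :=
  Set.Finite.isCompact_convexHull ℝ s.finite_toSet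

theorem measurableSet_hull (s : Finset Plane) : MeasurableSet (hull s) :=
  (isCompact_hull s).isClosed.measurableSet

theorem integrableOn_hull {s : Finset Plane} {f : Plane → ℝ} (hf : Continuous f) :
    IntegrableOn f (hull s) :=
  hf.continuousOn.integrableOn_compact (isCompact_hull s)

theorem volume_hull_triple (z a b : Plane) (h : cross (a - z) (b - z) ≠ 0) :
    volume.real (hull {z, a, b}) = |cross (a - z) (b - z)| / 2 := by
  have h1 := triangleIntegral_affine z a b h (AffineMap.const ℝ Plane (1 : ℝ))
  simp only [triangleIntegral, AffineMap.const_apply, integral_const, smul_eq_mul, mul_one,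
    measureReal_restrict_apply_univ] at h1
  rw [h1]; ring

/-- Arc length parametrization of the integral over an edge. -/
theorem edgeIntegral_pair {a b : Plane} (hab : a ≠ b) (f : Plane → ℝ) :
    edgeIntegral {a, b} f = dist a b * ∫ t in (0 : ℝ)..1, f (a + t • (b - a)) := by
  have hd : 0 < dist a b := dist_pos.2 hab
  have hd' : ‖b - a‖ = dist a b := by rw [dist_comm, dist_eq_norm]
  set d := dist a b with hdd
  let u : Plane := d⁻¹ • (b - a)
  have hu : ‖u‖ = 1 := by
    rw [norm_smul, hd', norm_inv, Real.norm_of_nonneg hd.le, inv_mul_cancel₀ hd.ne']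
  let g : ℝ → Plane := fun t => a + t • u
  have hg : Isometry g := by
    refine Isometry.of_dist_eq fun s t => ?_
    simp only [g, dist_add_left]
    rw [dist_eq_norm, ← sub_smul, norm_smul, hu, mul_one, Real.dist_eq, Real.norm_eq_abs]
  have himg : hull {a, b} = g '' Set.Icc 0 d := by
    ext x
    rw [mem_hull_pair]
    constructor
    · rintro ⟨t, h0, h1, rfl⟩
      refine ⟨t * d, ⟨by positivity, by nlinarith⟩, ?_⟩
      simp only [g, u, smul_smul]
      rw [mul_assoc, mul_inv_cancel₀ hd.ne', mul_one]
    · rintro ⟨s, ⟨h0, h1⟩, rfl⟩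
      refine ⟨s * d⁻¹, by positivity, ?_, ?_⟩
      · rw [← div_eq_mul_inv]; exact (div_le_one hd).2 h1
      · simp only [g, u, smul_smul]
  have hemb : MeasurableEmbedding g := hg.isClosedEmbedding.measurableEmbedding
  have hmap := hg.map_hausdorffMeasure (d := 1) (Or.inl zero_le_one)
  rw [hausdorffMeasure_real] at hmap
  have hsub : hull {a, b} ⊆ Set.range g := by rw [himg]; exact Set.image_subset_range _ _
  have h1 : edgeIntegral {a, b} f = ∫ t in Set.Icc 0 d, f (g t) := by
    have e : (Measure.hausdorffMeasure 1 : Measure Plane).restrict (hull {a, b})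
        = (Measure.map g volume).restrict (hull {a, b}) := by
      rw [hmap, Measure.restrict_restrict (measurableSet_hull _),
        Set.inter_eq_left.2 hsub]
    rw [edgeIntegral, e, hemb.setIntegral_map, himg, hg.injective.preimage_image]
  rw [h1, integral_Icc_eq_integral_Ioc, ← intervalIntegral.integral_of_le hd.le]
  have h2 := intervalIntegral.integral_comp_mul_left (fun t => f (g t)) (a := 0) (b := 1) hd.ne'
  have h3 : ∀ t : ℝ, g (d * t) = a + t • (b - a) := by
    intro t
    simp only [g, u, smul_smul]
    rw [mul_comm d t, mul_assoc, mul_inv_cancel₀ hd.ne', mul_one]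
  simp only [h3, mul_zero, mul_one, smul_eq_mul] at h2
  rw [h2, mul_inv_cancel_left₀ hd.ne']

theorem affine_apply_segment (p : ScalarP1) (a b : Plane) (t : ℝ) :
    p (a + t • (b - a)) = p a + (p b - p a) * t := by
  have e : a + t • (b - a) = (t • (b -ᵥ a)) +ᵥ a := by
    simp only [vsub_eq_sub, vadd_eq_add]; abel
  rw [e, AffineMap.map_vadd, map_smul, AffineMap.linearMap_vsub]
  simp only [vsub_eq_sub, vadd_eq_add, smul_eq_mul]
  ring

/-- The integral of a product of two affine functions over an edge. -/
theorem edgeIntegral_mul {a b : Plane} (hab : a ≠ b) (p q : ScalarP1) :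
    edgeIntegral {a, b} (fun x => p x * q x)
      = dist a b / 6 * (2 * (p a * q a) + p a * q b + p b * q a + 2 * (p b * q b)) := by
  rw [edgeIntegral_pair hab]
  simp_rw [affine_apply_segment]
  have : (fun t : ℝ => (p a + (p b - p a) * t) * (q a + (q b - q a) * t)) =
      fun t => p a * q a + (p a * (q b - q a) + (p b - p a) * q a) * t
        + ((p b - p a) * (q b - q a)) * t ^ 2 := by
    funext x; ring
  rw [this, integral_quadratic]
  ring

/-! ### Nondegenerate triangles -/

/-- A set of three affinely independent points, that is, a nondegenerate triangle. -/
structure IsTriangle (T : Finset Plane) : Prop where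
  card_eq : T.card = 3
  indep : AffineIndependent ℝ ((↑) : T → Plane)

theorem cross_sub_cycle (z a b : Plane) : cross (b - a) (z - a) = cross (a - z) (b - z) := by
  simp only [cross, PiLp.sub_apply]; ring

theorem cross_comm (u v : Plane) : cross u v = -cross v u := by
  simp only [cross]; ring

/-- Cramer's rule in the plane. -/
theorem cross_smul_eq (u w y : Plane) :
    cross u w • y = cross y w • u + cross u y • w := by
  ext i
  fin_cases i <;> simp [cross] <;> ring

theorem exists_smul_of_cross_eq_zero {u v : Plane} (hu : u ≠ 0) (h : cross u v = 0) :
    ∃ t : ℝ, v = t • u := by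
  have hN : u 0 ^ 2 + u 1 ^ 2 ≠ 0 := by
    intro h0
    apply hu
    have h1 : u 0 = 0 := by nlinarith [sq_nonneg (u 0), sq_nonneg (u 1)]
    have h2 : u 1 = 0 := by nlinarith [sq_nonneg (u 0), sq_nonneg (u 1)]
    ext i
    fin_cases i <;> simp [h1, h2]
  simp only [cross] at h
  refine ⟨(u 0 * v 0 + u 1 * v 1) / (u 0 ^ 2 + u 1 ^ 2), ?_⟩
  ext i
  fin_cases i
  · simp only [Fin.zero_eta, PiLp.smul_apply, smul_eq_mul]
    field_simp
    linear_combination (-u 1) * h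
  · simp only [Fin.mk_one, PiLp.smul_apply, smul_eq_mul]
    field_simp
    linear_combination (u 0) * h

theorem insert_rotate (z a b : Plane) : ({z, a, b} : Finset Plane) = {a, b, z} := by
  ext x; simp only [Finset.mem_insert, Finset.mem_singleton]; tauto

theorem insert_swap (z a b : Plane) : ({z, a, b} : Finset Plane) = {z, b, a} := by
  ext x; simp only [Finset.mem_insert, Finset.mem_singleton]; tauto

theorem IsTriangle.ne {z a b : Plane} (h : IsTriangle {z, a, b}) : z ≠ a ∧ z ≠ b ∧ a ≠ b :=
  by
  have hc := h.card_eq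
  refine ⟨?_, ?_, ?_⟩ <;> rintro rfl
  · have := Finset.card_le_two (a := z) (b := b)
    simp at hc; omega
  · have := Finset.card_le_two (a := z) (b := a)
    rw [insert_swap] at hc
    simp at hc; omega
  · have := Finset.card_le_two (a := z) (b := a)
    simp at hc; omega

theorem IsTriangle.cross_ne_zero {z a b : Plane} (h : IsTriangle {z, a, b}) :
    cross (a - z) (b - z) ≠ 0 := by
  obtain ⟨hza, hzb, hab⟩ := h.ne
  intro h0
  obtain ⟨t, ht⟩ := exists_smul_of_cross_eq_zero (sub_ne_zero.2 hza.symm) h0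
  have hb : b ∈ affineSpan ℝ (({z, a} : Set Plane)) := by
    have : b = AffineMap.lineMap z a t := by
      rw [AffineMap.lineMap_apply_module', ← ht]; abel
    rw [this]
    exact AffineMap.lineMap_mem_affineSpan_pair _ _ _
  refine h.indep.notMem_affineSpan_sdiff ⟨b, by simp⟩ Set.univ (affineSpan_mono ℝ ?_ hb)
  rintro x (rfl | rfl)
  · exact ⟨⟨x, by simp⟩, ⟨trivial, fun h => hzb (congrArg Subtype.val h)⟩, rfl⟩
  · exact ⟨⟨x, by simp⟩, ⟨trivial, fun h => hab (congrArg Subtype.val h)⟩, rfl⟩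

theorem triangleEdges_triple {z a b : Plane} (h : IsTriangle {z, a, b}) :
    triangleEdges {z, a, b} = {{z, a}, {a, b}, {b, z}} := by
  obtain ⟨hza, hzb, hab⟩ := h.ne
  ext e
  rw [triangleEdges, Finset.mem_powersetCard]
  constructor
  · rintro ⟨hs, hc⟩
    obtain ⟨x, y, hxy, rfl⟩ := Finset.card_eq_two.1 hc
    have hx := hs (Finset.mem_insert_self x {y})
    have hy := hs (Finset.mem_insert_of_mem (Finset.mem_singleton_self y))
    simp only [Finset.mem_insert, Finset.mem_singleton] at hx hy ⊢
    rcases hx with rfl | rfl | rfl <;> rcases hy with rfl | rfl | rfl <;>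
      first
        | exact absurd rfl hxy
        | simp
        | simp [Finset.pair_comm]
  · intro he
    simp only [Finset.mem_insert, Finset.mem_singleton] at he
    rcases he with rfl | rfl | rfl
    · exact ⟨by intro x; simp; tauto, Finset.card_pair hza⟩
    · exact ⟨by intro x; simp; tauto, Finset.card_pair hab⟩
    · exact ⟨by intro x; simp; tauto, Finset.card_pair hzb.symm⟩

theorem boundaryIntegral_triple {z a b : Plane} (h : IsTriangle {z, a, b})
    (f : Finset Plane → Plane → ℝ) :
    boundaryIntegral {z, a, b} f = edgeIntegral {z, a} (f {z, a}) + edgeIntegral {a, b} (f {a, b})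
      + edgeIntegral {b, z} (f {b, z}) := by
  obtain ⟨hza, hzb, hab⟩ := h.ne
  have hne : ∀ {x y w : Plane}, w ≠ x → w ≠ y → ∀ v : Plane,
      ({x, y} : Finset Plane) ≠ {v, w} := by
    intro x y w h1 h2 v he
    have : w ∈ ({x, y} : Finset Plane) := by rw [he]; simp
    simp only [Finset.mem_insert, Finset.mem_singleton] at this
    tauto
  rw [boundaryIntegral, triangleEdges_triple h, Finset.sum_insert, Finset.sum_pair, add_assoc]
  · exact hne hza hzb b
  · simp only [Finset.mem_insert, Finset.mem_singleton, not_or]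
    refine ⟨hne hzb.symm hab.symm a, ?_⟩
    rw [Finset.pair_comm b z]
    exact hne hzb.symm hab.symm z

theorem IsTriangle.isOutwardNormal {T e : Finset Plane} (h : IsTriangle T)
    (he : e ∈ triangleEdges T) : IsOutwardNormal T e (outwardNormal T e) := by
  have hex := exists_isOutwardNormal h.card_eq h.indep he
  rw [outwardNormal, dif_pos hex]
  exact hex.choose_spec

/-- The outward normal scaled by the length of the edge is the edge vector turned by a right angle,
clockwise for a positively oriented triangle. -/
theorem dist_mul_inner_outwardNormal {z a b : Plane} (h : IsTriangle {z, a, b}) (v : Plane) :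
    dist z a * ⟪v, outwardNormal {z, a, b} {z, a}⟫ =
      cross (a - z) (b - z) / |cross (a - z) (b - z)| * cross v (a - z) := by
  obtain ⟨hza, hzb, hab⟩ := h.ne
  have hn := h.isOutwardNormal (e := {z, a}) (by rw [triangleEdges_triple h]; simp)
  set n := outwardNormal {z, a, b} {z, a}
  have hD := h.cross_ne_zero
  have h1 : n 0 ^ 2 + n 1 ^ 2 = 1 := by
    have := hn.norm_eq_one
    rw [EuclideanSpace.norm_eq, Real.sqrt_eq_one] at this
    simpa [Fin.sum_univ_two] using this
  have h2 : n 0 * (a 0 - z 0) + n 1 * (a 1 - z 1) = 0 := by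
    have := hn.orthogonal z (by simp) a (by simp)
    simpa [PiLp.inner_apply, Fin.sum_univ_two, mul_comm] using this
  have h3 : n 0 * (b 0 - z 0) + n 1 * (b 1 - z 1) < 0 := by
    have := hn.outward z (by simp) b (by simp) (by simp [hzb.symm, hab.symm])
    simpa [PiLp.inner_apply, Fin.sum_univ_two, mul_comm] using this
  have hd : 0 < dist z a := dist_pos.2 hza
  have hd2 : dist z a ^ 2 = (a 0 - z 0) ^ 2 + (a 1 - z 1) ^ 2 := by
    rw [EuclideanSpace.dist_eq, Real.sq_sqrt (by positivity)]
    simp [Fin.sum_univ_two, Real.dist_eq, sq_abs]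
    ring
  set d := dist z a
  -- `n` is `κ` times the turned edge vector, and `κ d` is a sign.
  set κ := n 0 * (a 1 - z 1) - n 1 * (a 0 - z 0) with hκ
  have hk1 : d ^ 2 * n 0 = κ * (a 1 - z 1) := by
    rw [hκ, hd2]; linear_combination (a 0 - z 0) * h2
  have hk2 : d ^ 2 * n 1 = -κ * (a 0 - z 0) := by
    rw [hκ, hd2]; linear_combination (a 1 - z 1) * h2
  have hκd : κ ^ 2 = d ^ 2 := by
    rw [hd2]
    have : κ ^ 2 = (n 0 ^ 2 + n 1 ^ 2) * ((a 0 - z 0) ^ 2 + (a 1 - z 1) ^ 2)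
      - (n 0 * (a 0 - z 0) + n 1 * (a 1 - z 1)) ^ 2 := by rw [hκ]; ring
    rw [this, h1, h2]; ring
  have hcr : cross (a - z) (b - z)
      = (a 0 - z 0) * (b 1 - z 1) - (a 1 - z 1) * (b 0 - z 0) := by simp [cross]
  have hpos : 0 < κ * cross (a - z) (b - z) := by
    have : κ * cross (a - z) (b - z)
        = - (d ^ 2 * (n 0 * (b 0 - z 0) + n 1 * (b 1 - z 1))) := by
      rw [hcr]; linear_combination (b 0 - z 0) * hk1 + (b 1 - z 1) * hk2
    rw [this]
    have := mul_neg_of_pos_of_neg (pow_pos hd 2) h3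
    linarith
  have hs : κ = d * (cross (a - z) (b - z) / |cross (a - z) (b - z)|) := by
    set D := cross (a - z) (b - z)
    rcases sq_eq_sq_iff_eq_or_eq_neg.1 hκd with e | e
    · rw [e] at hpos ⊢
      have : 0 < D := by
        by_contra hc; nlinarith [mul_nonneg hd.le (neg_nonneg.2 (not_lt.1 hc))]
      rw [abs_of_pos this, div_self this.ne', mul_one]
    · rw [e] at hpos ⊢
      have : D < 0 := by
        by_contra hc; nlinarith [mul_nonneg hd.le (not_lt.1 hc)]
      rw [abs_of_neg this, div_neg, div_self this.ne]; ring
  have hin : ⟪v, n⟫ = n 0 * v 0 + n 1 * v 1 := by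
    simp [PiLp.inner_apply, Fin.sum_univ_two]
  rw [hin]
  apply mul_left_cancel₀ hd.ne'
  have hcv : cross v (a - z) = v 0 * (a 1 - z 1) - v 1 * (a 0 - z 0) := by simp [cross]
  calc d * (d * (n 0 * v 0 + n 1 * v 1)) = κ * cross v (a - z) := by
        rw [hcv]; linear_combination v 0 * hk1 + v 1 * hk2
    _ = _ := by rw [hs]; ring

/-! ### The divergence theorem for affine functions on a triangle -/

/-- The constant gradient of an affine function. -/
noncomputable def grad (u : ScalarP1) : Plane := (InnerProductSpace.toDual ℝ Plane).symm
  (LinearMap.toContinuousLinearMap u.linear)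

theorem inner_grad (u : ScalarP1) (w : Plane) : ⟪grad u, w⟫ = u.linear w := by
  simp [grad]

theorem gradient_eq_grad (u : ScalarP1) (x : Plane) : gradient (fun y => u y) x = grad u := by
  have h : HasFDerivAt (fun y => u y) (LinearMap.toContinuousLinearMap u.linear) x := by
    have e : (fun y => u y) = fun y => LinearMap.toContinuousLinearMap u.linear y + u 0 := by
      funext y
      have := congrFun u.decomp y
      simpa using this
    rw [e]
    exact (ContinuousLinearMap.hasFDerivAt _).add_const _
  rw [gradient, h.fderiv, grad]

theorem affine_sub_eq (u : ScalarP1) (x y : Plane) : u x - u y = ⟪grad u, x - y⟫ := by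
  rw [inner_grad]
  have := u.linearMap_vsub x y
  simpa using this.symm

theorem divergence_eq (v : VectorP1) :
    divergence v = v.linear (EuclideanSpace.single 0 1) 0
      + v.linear (EuclideanSpace.single 1 1) 1 := by
  rw [divergence, LinearMap.trace_eq_matrix_trace ℝ (EuclideanSpace.basisFun (Fin 2) ℝ).toBasis,
    Matrix.trace_fin_two]
  simp [LinearMap.toMatrix_apply]

theorem continuous_scalarP1 (p : ScalarP1) : Continuous fun x => p x :=
  p.continuous_of_finiteDimensional

theorem continuous_vectorP1 (p : VectorP1) : Continuous fun x => p x :=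
  p.continuous_of_finiteDimensional

/-- The component `x ↦ ⟪n, v x⟫` of an affine vector field. -/
noncomputable def innerP1 (n : Plane) (v : VectorP1) : ScalarP1 :=
  (innerSL ℝ n).toLinearMap.toAffineMap.comp v

@[simp]
theorem innerP1_apply (n : Plane) (v : VectorP1) (x : Plane) : innerP1 n v x = ⟪n, v x⟫ := by
  simp [innerP1]

/-- The flux of an affine vector field, weighted by an affine function, through the first edge. -/
theorem edgeIntegral_flux {z a b : Plane} (h : IsTriangle {z, a, b}) (p : ScalarP1)
    (v : VectorP1) :
    edgeIntegral {z, a} (fun x => p x * ⟪v x, outwardNormal {z, a, b} {z, a}⟫)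
      = cross (a - z) (b - z) / |cross (a - z) (b - z)| / 6 *
        (2 * (p z * cross (v z) (a - z)) + p z * cross (v a) (a - z)
          + p a * cross (v z) (a - z) + 2 * (p a * cross (v a) (a - z))) := by
  have h1 := edgeIntegral_mul h.ne.1 p (innerP1 (outwardNormal {z, a, b} {z, a}) v)
  simp only [innerP1_apply] at h1
  have e : (fun x => p x * ⟪v x, outwardNormal {z, a, b} {z, a}⟫)
      = fun x => p x * ⟪outwardNormal {z, a, b} {z, a}, v x⟫ := by
    funext x; rw [real_inner_comm]
  rw [e, h1, real_inner_comm, real_inner_comm (v a)]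
  have hz := dist_mul_inner_outwardNormal h (v z)
  have ha := dist_mul_inner_outwardNormal h (v a)
  linear_combination (1 / 6 * (2 * p z + p a)) * hz + (1 / 6 * (p z + 2 * p a)) * ha

theorem boundaryIntegral_flux {z a b : Plane} (h : IsTriangle {z, a, b})
    (p : Finset Plane → ScalarP1) (v : VectorP1) :
    boundaryIntegral {z, a, b} (fun e x => p e x * ⟪v x, outwardNormal {z, a, b} e⟫)
      = cross (a - z) (b - z) / |cross (a - z) (b - z)| / 6 *
        ((2 * (p {z, a} z * cross (v z) (a - z)) + p {z, a} z * cross (v a) (a - z)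
          + p {z, a} a * cross (v z) (a - z) + 2 * (p {z, a} a * cross (v a) (a - z)))
        + (2 * (p {a, b} a * cross (v a) (b - a)) + p {a, b} a * cross (v b) (b - a)
          + p {a, b} b * cross (v a) (b - a) + 2 * (p {a, b} b * cross (v b) (b - a)))
        + (2 * (p {b, z} b * cross (v b) (z - b)) + p {b, z} b * cross (v z) (z - b)
          + p {b, z} z * cross (v b) (z - b) + 2 * (p {b, z} z * cross (v z) (z - b)))) := by
  rw [boundaryIntegral_triple h, edgeIntegral_flux h]
  have h2 : IsTriangle {a, b, z} := insert_rotate z a b ▸ h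
  have h3 : IsTriangle {b, z, a} := insert_rotate a b z ▸ h2
  have e2 := edgeIntegral_flux h2 (p {a, b}) v
  have e3 := edgeIntegral_flux h3 (p {b, z}) v
  rw [← insert_rotate z a b, cross_sub_cycle] at e2
  rw [← insert_rotate a b z, ← insert_rotate z a b, cross_sub_cycle, cross_sub_cycle] at e3
  rw [e2, e3]
  ring

/-- Integration by parts on a triangle: `(∇u, v)_T + (u, div v)_T = ⟨u, v · n⟩_{∂T}` for affine
`u` and `v`. -/
theorem integral_by_parts {T : Finset Plane} (hT : IsTriangle T) (u : ScalarP1) (v : VectorP1) :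
    triangleIntegral T (fun x => ⟪grad u, v x⟫ + u x * divergence v)
      = boundaryIntegral T (fun e x => u x * ⟪v x, outwardNormal T e⟫) := by
  obtain ⟨z, a, b, -, -, -, rfl⟩ := Finset.card_eq_three.1 hT.card_eq
  rw [boundaryIntegral_flux hT (fun _ => u) v]
  have h1 := triangleIntegral_affine z a b hT.cross_ne_zero (innerP1 (grad u) v + divergence v • u)
  have e : (fun x => (innerP1 (grad u) v + divergence v • u) x)
      = fun x => ⟪grad u, v x⟫ + u x * divergence v := by
    funext x
    simp [mul_comm]
  rw [e] at h1
  rw [h1]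
  have hD := hT.cross_ne_zero
  have habs : |cross (a - z) (b - z)|
      = cross (a - z) (b - z) / |cross (a - z) (b - z)| * cross (a - z) (b - z) := by
    have := abs_pos.2 hD
    field_simp
    rw [sq_abs]
  set s := cross (a - z) (b - z) / |cross (a - z) (b - z)| with hs
  clear_value s
  rw [habs]
  -- both sides are now polynomial in the coordinates
  have hlin : ∀ y : Plane, v y = v z + v.linear (y - z) := by
    intro y
    have := v.linearMap_vsub y z
    simp only [vsub_eq_sub] at this
    rw [this]; abel
  have hsplit : ∀ w : Plane, w = w 0 • EuclideanSpace.single 0 (1 : ℝ)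
      + w 1 • EuclideanSpace.single 1 (1 : ℝ) := by
    intro w
    ext i
    fin_cases i <;> simp
  have hv : ∀ (y : Plane) (i : Fin 2), v y i = v z i
      + ((y 0 - z 0) * v.linear (EuclideanSpace.single 0 1) i
        + (y 1 - z 1) * v.linear (EuclideanSpace.single 1 1) i) := by
    intro y i
    conv_lhs => rw [hlin y, hsplit (y - z), map_add, map_smul, map_smul]
    simp
  have hu : ∀ y : Plane, u y = u z + (grad u 0 * (y 0 - z 0) + grad u 1 * (y 1 - z 1)) := by
    intro y
    have := affine_sub_eq u y z
    simp only [PiLp.inner_apply, Fin.sum_univ_two, PiLp.sub_apply, RCLike.inner_apply,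
      conj_trivial] at this
    linarith
  simp only [Pi.add_apply, AffineMap.coe_add, AffineMap.coe_smul, Pi.smul_apply,
    innerP1_apply, smul_eq_mul, divergence_eq, PiLp.inner_apply, Fin.sum_univ_two,
    RCLike.inner_apply, conj_trivial, cross, PiLp.sub_apply]
  rw [hv a 0, hv a 1, hv b 0, hv b 1, hu a, hu b]
  ring

/-! ### Linearity and positivity of the integrals -/

theorem triangleIntegral_add {T : Finset Plane} {f g : Plane → ℝ} (hf : Continuous f)
    (hg : Continuous g) :
    triangleIntegral T (fun x => f x + g x) = triangleIntegral T f + triangleIntegral T g :=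
  integral_add (integrableOn_hull hf) (integrableOn_hull hg)

theorem triangleIntegral_sub {T : Finset Plane} {f g : Plane → ℝ} (hf : Continuous f)
    (hg : Continuous g) :
    triangleIntegral T (fun x => f x - g x) = triangleIntegral T f - triangleIntegral T g :=
  integral_sub (integrableOn_hull hf) (integrableOn_hull hg)

theorem triangleIntegral_const_mul (T : Finset Plane) (c : ℝ) (f : Plane → ℝ) :
    triangleIntegral T (fun x => c * f x) = c * triangleIntegral T f :=
  integral_const_mul _ _

theorem triangleIntegral_nonneg (T : Finset Plane) {f : Plane → ℝ} (hf : ∀ x, 0 ≤ f x) :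
    0 ≤ triangleIntegral T f :=
  integral_nonneg hf

theorem edgeIntegral_congr {e : Finset Plane} {f g : Plane → ℝ} (h : ∀ x ∈ hull e, f x = g x) :
    edgeIntegral e f = edgeIntegral e g :=
  setIntegral_congr_fun (measurableSet_hull e) h

theorem boundaryIntegral_congr {T : Finset Plane} {f g : Finset Plane → Plane → ℝ}
    (h : ∀ e ∈ triangleEdges T, ∀ x ∈ hull e, f e x = g e x) :
    boundaryIntegral T f = boundaryIntegral T g :=
  Finset.sum_congr rfl fun e he => edgeIntegral_congr (h e he)

theorem boundaryIntegral_add {T : Finset Plane} {f g : Finset Plane → Plane → ℝ}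
    (hf : ∀ e, Continuous (f e)) (hg : ∀ e, Continuous (g e)) :
    boundaryIntegral T (fun e x => f e x + g e x)
      = boundaryIntegral T f + boundaryIntegral T g := by
  rw [boundaryIntegral, boundaryIntegral, boundaryIntegral, ← Finset.sum_add_distrib]
  refine Finset.sum_congr rfl fun e he => ?_
  obtain ⟨a, b, hab, rfl⟩ := Finset.card_eq_two.1 (Finset.mem_powersetCard.1 he).2
  have hp : Continuous fun t : ℝ => a + t • (b - a) := by fun_prop
  rw [edgeIntegral_pair hab, edgeIntegral_pair hab, edgeIntegral_pair hab, ← mul_add]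
  congr 1
  exact intervalIntegral.integral_add (((hf _).comp hp).intervalIntegrable _ _)
    (((hg _).comp hp).intervalIntegrable _ _)

theorem boundaryIntegral_const_mul (T : Finset Plane) (c : ℝ) (f : Finset Plane → Plane → ℝ) :
    boundaryIntegral T (fun e x => c * f e x) = c * boundaryIntegral T f := by
  rw [boundaryIntegral, boundaryIntegral, Finset.mul_sum]
  exact Finset.sum_congr rfl fun e _ => integral_const_mul _ _

theorem boundaryIntegral_nonneg (T : Finset Plane) {f : Finset Plane → Plane → ℝ}
    (hf : ∀ e x, 0 ≤ f e x) : 0 ≤ boundaryIntegral T f :=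
  Finset.sum_nonneg fun e _ => integral_nonneg (hf e)

/-- The Cauchy-Schwarz inequality on a triangle. -/
theorem triangleIntegral_inner_sq_le (T : Finset Plane) (f g : VectorP1) :
    triangleIntegral T (fun x => ⟪f x, g x⟫) ^ 2
      ≤ triangleIntegral T (fun x => ⟪f x, f x⟫) * triangleIntegral T (fun x => ⟪g x, g x⟫) := by
  have hf := continuous_vectorP1 f
  have hg := continuous_vectorP1 g
  have key : ∀ t : ℝ, 0 ≤ triangleIntegral T (fun x => ⟪g x, g x⟫) * (t * t)
      + 2 * triangleIntegral T (fun x => ⟪f x, g x⟫) * t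
      + triangleIntegral T (fun x => ⟪f x, f x⟫) := by
    intro t
    have h0 : 0 ≤ triangleIntegral T (fun x => (t * t) * ⟪g x, g x⟫
        + ((2 * t) * ⟪f x, g x⟫ + ⟪f x, f x⟫)) := by
      refine triangleIntegral_nonneg T fun x => ?_
      have := real_inner_self_nonneg (x := t • g x + f x)
      rw [real_inner_add_add_self, inner_smul_left, inner_smul_right, inner_smul_left,
        real_inner_comm (f x) (g x)] at this
      simp only [conj_trivial] at this
      linarith
    rw [triangleIntegral_add (by fun_prop) (by fun_prop),
      triangleIntegral_add (by fun_prop) (by fun_prop), triangleIntegral_const_mul,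
      triangleIntegral_const_mul] at h0
    linarith
  have := discrim_le_zero key
  rw [discrim] at this
  linarith

/-! ### The local solver -/

@[simp] theorem grad_add (u v : ScalarP1) : grad (u + v) = grad u + grad v := by
  refine ext_inner_right ℝ fun w => ?_
  simp [inner_add_left, inner_grad]

@[simp] theorem grad_smul (c : ℝ) (u : ScalarP1) : grad (c • u) = c • grad u := by
  refine ext_inner_right ℝ fun w => ?_
  simp [inner_smul_left, inner_grad]

@[simp] theorem grad_zero : grad 0 = 0 := by
  refine ext_inner_right ℝ fun w => ?_
  simp [inner_grad]

@[simp] theorem divergence_add (u v : VectorP1) :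
    divergence (u + v) = divergence u + divergence v := by
  simp [divergence]

@[simp] theorem divergence_smul (c : ℝ) (u : VectorP1) : divergence (c • u) = c * divergence u := by
  simp [divergence]

@[simp] theorem divergence_zero : divergence 0 = 0 := by
  simp [divergence]

/-- The sum of the left hand sides of the two equations of the local problem, as a bilinear form
on `V(T) × W(T)`. -/
noncomputable def localForm (τ : ℝ) (T : Finset Plane) :
    (VectorP1 × ScalarP1) →ₗ[ℝ] (VectorP1 × ScalarP1) →ₗ[ℝ] ℝ :=
  LinearMap.mk₂ ℝ (fun s t =>
      triangleIntegral T (fun x => ⟪s.1 x, t.1 x⟫ - s.2 x * divergence t.1 - ⟪s.1 x, grad t.2⟫)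
        + boundaryIntegral T (fun e x => (⟪s.1 x, outwardNormal T e⟫ + τ * s.2 x) * t.2 x))
    (by
      intro s s' t
      have h1 := continuous_vectorP1 s.1
      have h2 := continuous_vectorP1 s'.1
      have h3 := continuous_vectorP1 t.1
      have h4 := continuous_scalarP1 s.2
      have h5 := continuous_scalarP1 s'.2
      have h6 := continuous_scalarP1 t.2
      rw [add_add_add_comm, ← triangleIntegral_add (by fun_prop) (by fun_prop),
        ← boundaryIntegral_add (fun e => by fun_prop) (fun e => by fun_prop)]
      congr 2
      · funext x
        simp [inner_add_left]; ring
      · funext e x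
        simp [inner_add_left]; ring)
    (by
      intro c s t
      rw [smul_add, smul_eq_mul, smul_eq_mul, ← triangleIntegral_const_mul,
        ← boundaryIntegral_const_mul]
      congr 2
      · funext x
        simp [inner_smul_left]; ring
      · funext e x
        simp [inner_smul_left]; ring)
    (by
      intro s t t'
      have h1 := continuous_vectorP1 s.1
      have h2 := continuous_vectorP1 t.1
      have h3 := continuous_vectorP1 t'.1
      have h4 := continuous_scalarP1 s.2
      have h5 := continuous_scalarP1 t.2
      have h6 := continuous_scalarP1 t'.2
      rw [add_add_add_comm, ← triangleIntegral_add (by fun_prop) (by fun_prop),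
        ← boundaryIntegral_add (fun e => by fun_prop) (fun e => by fun_prop)]
      congr 2
      · funext x
        simp [inner_add_right]; ring
      · funext e x
        simp; ring)
    (by
      intro c s t
      rw [smul_add, smul_eq_mul, smul_eq_mul, ← triangleIntegral_const_mul,
        ← boundaryIntegral_const_mul]
      congr 2
      · funext x
        simp [inner_smul_right]; ring
      · funext e x
        simp; ring)

theorem localForm_apply (τ : ℝ) (T : Finset Plane) (s t : VectorP1 × ScalarP1) :
    localForm τ T s t =
      triangleIntegral T (fun x => ⟪s.1 x, t.1 x⟫ - s.2 x * divergence t.1 - ⟪s.1 x, grad t.2⟫)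
        + boundaryIntegral T (fun e x => (⟪s.1 x, outwardNormal T e⟫ + τ * s.2 x) * t.2 x) := rfl

theorem isLocalSolution_iff {τ : ℝ} {T : Finset Plane} {m : Finset Plane → Plane → ℝ}
    {p : Finset Plane → ScalarP1} (hp : ∀ e ∈ triangleEdges T, ∀ x ∈ hull e, m e x = p e x)
    (s : VectorP1 × ScalarP1) :
    IsLocalSolution τ T m s ↔ ∀ t : VectorP1 × ScalarP1, localForm τ T s t
      = -boundaryIntegral T (fun e x => p e x * ⟪t.1 x, outwardNormal T e⟫)
        + τ * boundaryIntegral T (fun e x => p e x * t.2 x) := by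
  have hs1 := continuous_vectorP1 s.1
  have hs2 := continuous_scalarP1 s.2
  have hpc := fun e => continuous_scalarP1 (p e)
  have hflux : ∀ v : VectorP1, boundaryIntegral T (fun e x => m e x * ⟪v x, outwardNormal T e⟫)
      = boundaryIntegral T (fun e x => p e x * ⟪v x, outwardNormal T e⟫) := fun v =>
    boundaryIntegral_congr fun e he x hx => by rw [hp e he x hx]
  have hcons : ∀ w : ScalarP1, boundaryIntegral T
        (fun e x => (⟪s.1 x, outwardNormal T e⟫ + τ * (s.2 x - m e x)) * w x)
      = boundaryIntegral T (fun e x => (⟪s.1 x, outwardNormal T e⟫ + τ * s.2 x) * w x)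
        - τ * boundaryIntegral T (fun e x => p e x * w x) := by
    intro w
    have hw := continuous_scalarP1 w
    have h1 := boundaryIntegral_add (T := T)
      (f := fun e x => (⟪s.1 x, outwardNormal T e⟫ + τ * s.2 x) * w x)
      (g := fun e x => (-τ) * (p e x * w x)) (fun e => by fun_prop) (fun e => by fun_prop)
    rw [boundaryIntegral_const_mul] at h1
    rw [sub_eq_add_neg, ← neg_mul, ← h1]
    refine boundaryIntegral_congr fun e he x hx => ?_
    rw [hp e he x hx]; ring
  have hsplit : ∀ t : VectorP1 × ScalarP1, localForm τ T s t
      = (triangleIntegral T (fun x => ⟪s.1 x, t.1 x⟫)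
          - triangleIntegral T (fun x => s.2 x * divergence t.1))
        + (-triangleIntegral T (fun x => ⟪s.1 x, gradient (fun y => t.2 y) x⟫)
          + boundaryIntegral T
              (fun e x => (⟪s.1 x, outwardNormal T e⟫ + τ * s.2 x) * t.2 x)) := by
    intro t
    have ht1 := continuous_vectorP1 t.1
    have ht2 := continuous_scalarP1 t.2
    simp_rw [gradient_eq_grad]
    rw [localForm_apply, triangleIntegral_sub (by fun_prop) (by fun_prop),
      triangleIntegral_sub (by fun_prop) (by fun_prop)]
    ring
  constructor
  · intro h t
    have h1 := h.flux t.1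
    have h2 := h.conservation t.2
    rw [hflux] at h1
    rw [hcons] at h2
    rw [hsplit]
    linarith
  · intro h
    refine ⟨fun v => ?_, fun w => ?_⟩
    · have h1 := h (v, 0)
      rw [hsplit] at h1
      simp_rw [gradient_eq_grad] at h1
      rw [hflux]
      simpa [triangleIntegral, boundaryIntegral, edgeIntegral] using h1
    · have h1 := h (0, w)
      rw [hsplit] at h1
      rw [hcons]
      simp only [divergence_zero, mul_zero, AffineMap.coe_zero, Pi.zero_apply, inner_zero_left,
        inner_zero_right] at h1
      simp only [triangleIntegral, boundaryIntegral, edgeIntegral, integral_zero,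
        Finset.sum_const_zero] at h1 ⊢
      linarith

theorem affine_eq_zero_of_vertices {z a b : Plane} (h : cross (a - z) (b - z) ≠ 0) {u : ScalarP1}
    (hz : u z = 0) (ha : u a = 0) (hb : u b = 0) : u = 0 := by
  have h1 : u.linear (a - z) = 0 := by
    rw [← inner_grad, ← affine_sub_eq, ha, hz, sub_zero]
  have h2 : u.linear (b - z) = 0 := by
    rw [← inner_grad, ← affine_sub_eq, hb, hz, sub_zero]
  ext x
  have h3 := congrArg u.linear (cross_smul_eq (a - z) (b - z) (x - z))
  rw [map_smul, map_add, map_smul, map_smul, h1, h2, ← inner_grad, ← affine_sub_eq, hz] at h3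
  simpa [h] using h3

theorem IsTriangle.interior_nonempty {T : Finset Plane} (hT : IsTriangle T) :
    (interior (hull T)).Nonempty := by
  rw [hull, interior_convexHull_nonempty_iff_affineSpan_eq_top]
  have := hT.indep.affineSpan_eq_top_iff_card_eq_finrank_add_one.2
    (by simp [hT.card_eq])
  simpa using this

theorem eq_zero_of_triangleIntegral_inner_self {T : Finset Plane} (hT : IsTriangle T)
    {v : VectorP1} (h : triangleIntegral T (fun x => ⟪v x, v x⟫) = 0) : v = 0 := by
  have hc := continuous_vectorP1 v
  have h1 : (fun x => ⟪v x, v x⟫) =ᵐ[volume.restrict (hull T)] 0 :=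
    (setIntegral_eq_zero_iff_of_nonneg_ae
      (Filter.Eventually.of_forall fun x => real_inner_self_nonneg)
      (integrableOn_hull (by fun_prop))).1 h
  have h2 := Measure.eqOn_open_of_ae_eq (ae_restrict_of_ae_restrict_of_subset interior_subset h1)
    isOpen_interior (by fun_prop) continuousOn_const
  have h3 : ∀ x ∈ interior (hull T), v x = 0 := fun x hx => by
    simpa using h2 hx
  obtain ⟨x₀, hx₀⟩ := hT.interior_nonempty
  ext1 y
  have hcont : Continuous fun t : ℝ => x₀ + t • (y - x₀) := by fun_prop
  have hev : ∀ᶠ t in nhds (0 : ℝ), x₀ + t • (y - x₀) ∈ interior (hull T) :=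
    hcont.continuousAt.eventually_mem (isOpen_interior.mem_nhds (by simpa using hx₀))
  obtain ⟨t, ht, ht0⟩ := ((hev.filter_mono nhdsWithin_le_nhds).and
    (self_mem_nhdsWithin (s := {(0 : ℝ)}ᶜ))).exists
  have h4 := h3 _ ht
  have h5 : v (x₀ + t • (y - x₀)) = v x₀ + t • (v y - v x₀) := by
    have e : x₀ + t • (y - x₀) = (t • (y -ᵥ x₀)) +ᵥ x₀ := by
      simp only [vsub_eq_sub, vadd_eq_add]; abel
    rw [e, AffineMap.map_vadd, map_smul, AffineMap.linearMap_vsub]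
    simp only [vsub_eq_sub, vadd_eq_add]
    abel
  rw [h5, h3 _ hx₀, zero_add, sub_zero, smul_eq_zero] at h4
  exact h4.resolve_left ht0

theorem eq_zero_of_boundaryIntegral_mul_self {T : Finset Plane} (hT : IsTriangle T)
    {u : ScalarP1} (h : boundaryIntegral T (fun _ x => u x * u x) = 0) : u = 0 := by
  obtain ⟨z, a, b, hza, hzb, hab, rfl⟩ := Finset.card_eq_three.1 hT.card_eq
  rw [boundaryIntegral_triple hT, edgeIntegral_mul hza, edgeIntegral_mul hab,
    edgeIntegral_mul hzb.symm] at h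
  have key : ∀ {d x y : ℝ}, 0 < d → 0 ≤ d / 6 * (2 * (x * x) + x * y + y * x + 2 * (y * y)) := by
    intro d x y hd
    have : 0 ≤ 2 * (x * x) + x * y + y * x + 2 * (y * y) := by
      nlinarith [sq_nonneg (x + y), sq_nonneg x, sq_nonneg y]
    positivity
  have key2 : ∀ {d x y : ℝ}, 0 < d →
      d / 6 * (2 * (x * x) + x * y + y * x + 2 * (y * y)) = 0 → x = 0 ∧ y = 0 := by
    intro d x y hd h0
    have h1 := (mul_eq_zero.1 h0).resolve_left (by positivity)
    constructor <;> nlinarith [sq_nonneg (x + y), sq_nonneg x, sq_nonneg y]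
  have d1 := dist_pos.2 hza
  have d2 := dist_pos.2 hab
  have d3 := dist_pos.2 hzb.symm
  have k1 := key (x := u z) (y := u a) d1
  have k2 := key (x := u a) (y := u b) d2
  have k3 := key (x := u b) (y := u z) d3
  obtain ⟨hz, ha⟩ := key2 (x := u z) (y := u a) d1 (by linarith)
  obtain ⟨hb, -⟩ := key2 (x := u b) (y := u z) d3 (by linarith)
  exact affine_eq_zero_of_vertices hT.cross_ne_zero hz ha hb

/-- Integration by parts cancels the coupling terms of the local problem on the diagonal. -/
theorem localForm_self {T : Finset Plane} (hT : IsTriangle T) (τ : ℝ) (s : VectorP1 × ScalarP1) :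
    localForm τ T s s = triangleIntegral T (fun x => ⟪s.1 x, s.1 x⟫)
      + τ * boundaryIntegral T (fun _ x => s.2 x * s.2 x) := by
  have hs1 := continuous_vectorP1 s.1
  have hs2 := continuous_scalarP1 s.2
  have h1 := integral_by_parts hT s.2 s.1
  have h2 := triangleIntegral_sub (T := T) (f := fun x => ⟪s.1 x, s.1 x⟫)
    (g := fun x => ⟪grad s.2, s.1 x⟫ + s.2 x * divergence s.1) (by fun_prop) (by fun_prop)
  have h3 := boundaryIntegral_add (T := T) (f := fun e x => s.2 x * ⟪s.1 x, outwardNormal T e⟫)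
    (g := fun _ x => τ * (s.2 x * s.2 x)) (fun e => by fun_prop) (fun e => by fun_prop)
  rw [boundaryIntegral_const_mul] at h3
  have e1 : (fun x => ⟪s.1 x, s.1 x⟫ - s.2 x * divergence s.1 - ⟪s.1 x, grad s.2⟫)
      = fun x => ⟪s.1 x, s.1 x⟫ - (⟪grad s.2, s.1 x⟫ + s.2 x * divergence s.1) := by
    funext x; rw [real_inner_comm (s.1 x) (grad s.2)]; ring
  have e2 : (fun (e : Finset Plane) x => (⟪s.1 x, outwardNormal T e⟫ + τ * s.2 x) * s.2 x)
      = fun e x => s.2 x * ⟪s.1 x, outwardNormal T e⟫ + τ * (s.2 x * s.2 x) := by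
    funext e x; ring
  rw [localForm_apply, e1, e2, h2, h3, h1]
  ring

theorem localForm_injective {T : Finset Plane} (hT : IsTriangle T) {τ : ℝ} (hτ : 0 < τ) :
    Function.Injective (localForm τ T) := by
  rw [injective_iff_map_eq_zero]
  intro s hs
  have h := localForm_self hT τ s
  rw [hs, LinearMap.zero_apply] at h
  have h1 := triangleIntegral_nonneg T (f := fun x => ⟪s.1 x, s.1 x⟫)
    fun x => real_inner_self_nonneg
  have h2 := boundaryIntegral_nonneg T (f := fun _ x => s.2 x * s.2 x)
    fun _ x => mul_self_nonneg _
  have h3 := mul_nonneg hτ.le h2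
  refine Prod.ext (eq_zero_of_triangleIntegral_inner_self hT (by linarith))
    (eq_zero_of_boundaryIntegral_mul_self hT ?_)
  exact (mul_eq_zero.1 (by linarith)).resolve_left hτ.ne'

/-- The local problem is a square linear system with trivial kernel. -/
theorem existsUnique_isLocalSolution {T : Finset Plane} (hT : IsTriangle T) {τ : ℝ} (hτ : 0 < τ)
    {m : Finset Plane → Plane → ℝ}
    (hm : ∀ e ∈ triangleEdges T, ∃ p : ScalarP1, ∀ x ∈ hull e, m e x = p x) :
    ∃! s, IsLocalSolution τ T m s := by
  have : ∀ e, ∃ p : ScalarP1, e ∈ triangleEdges T → ∀ x ∈ hull e, m e x = p x := by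
    intro e
    by_cases he : e ∈ triangleEdges T
    · obtain ⟨p, hp⟩ := hm e he
      exact ⟨p, fun _ => hp⟩
    · exact ⟨0, fun h => absurd h he⟩
  choose p hp using this
  simp_rw [isLocalSolution_iff hp]
  have hinj := localForm_injective hT hτ
  have hsurj : Function.Surjective (localForm τ T) :=
    (LinearMap.injective_iff_surjective_of_finrank_eq_finrank
      (Subspace.dual_finrank_eq (K := ℝ) (V := VectorP1 × ScalarP1)).symm).1 hinj
  have hpc := fun e => continuous_scalarP1 (p e)
  let F : (VectorP1 × ScalarP1) →ₗ[ℝ] ℝ :=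
    { toFun := fun t => -boundaryIntegral T (fun e x => p e x * ⟪t.1 x, outwardNormal T e⟫)
        + τ * boundaryIntegral T (fun e x => p e x * t.2 x)
      map_add' := by
        intro t t'
        have h1 := continuous_vectorP1 t.1
        have h2 := continuous_vectorP1 t'.1
        have h3 := continuous_scalarP1 t.2
        have h4 := continuous_scalarP1 t'.2
        have e1 := boundaryIntegral_add (T := T)
          (f := fun e x => p e x * ⟪t.1 x, outwardNormal T e⟫)
          (g := fun e x => p e x * ⟪t'.1 x, outwardNormal T e⟫) (fun e => by fun_prop)
          (fun e => by fun_prop)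
        have e2 := boundaryIntegral_add (T := T)
          (f := fun e x => p e x * t.2 x) (g := fun e x => p e x * t'.2 x) (fun e => by fun_prop)
          (fun e => by fun_prop)
        simp only [Prod.fst_add, Prod.snd_add, AffineMap.coe_add, Pi.add_apply, inner_add_left,
          mul_add]
        rw [e1, e2]
        ring
      map_smul' := by
        intro c t
        have e1 := boundaryIntegral_const_mul T c
          (fun e x => p e x * ⟪t.1 x, outwardNormal T e⟫)
        have e2 := boundaryIntegral_const_mul T c (fun e x => p e x * t.2 x)
        simp only [Prod.smul_fst, Prod.smul_snd, AffineMap.coe_smul, Pi.smul_apply,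
          inner_smul_left, conj_trivial, smul_eq_mul, mul_left_comm _ c, RingHom.id_apply]
        rw [e1, e2]
        ring }
  obtain ⟨s, hs⟩ := hsurj F
  refine ⟨s, fun t => by rw [hs]; rfl, fun s' hs' => hinj ?_⟩
  rw [hs]
  exact LinearMap.ext hs'

theorem localSolution_spec {T : Finset Plane} (hT : IsTriangle T) {τ : ℝ} (hτ : 0 < τ)
    {m : Finset Plane → Plane → ℝ}
    (hm : ∀ e ∈ triangleEdges T, ∃ p : ScalarP1, ∀ x ∈ hull e, m e x = p x) :
    IsLocalSolution τ T m (localSolution τ T m) := by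
  have h := (existsUnique_isLocalSolution hT hτ hm).exists
  rw [localSolution, dif_pos h]
  exact h.choose_spec

/-- For the trace of an affine function `u` the local solution is `(-∇u, u)`. -/
theorem localSolution_affine {T : Finset Plane} (hT : IsTriangle T) {τ : ℝ} (hτ : 0 < τ)
    {m : Finset Plane → Plane → ℝ} {u : ScalarP1}
    (hm : ∀ e ∈ triangleEdges T, ∀ x ∈ hull e, m e x = u x) :
    localSolution τ T m = (AffineMap.const ℝ Plane (-grad u), u) := by
  refine (existsUnique_isLocalSolution hT hτ (fun e he => ⟨u, hm e he⟩)).unique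
    (localSolution_spec hT hτ (fun e he => ⟨u, hm e he⟩)) ?_
  have huc := continuous_scalarP1 u
  constructor
  · intro v
    have hvc := continuous_vectorP1 v
    have h1 := integral_by_parts hT u v
    rw [triangleIntegral_add (by fun_prop) (by fun_prop)] at h1
    have h2 := triangleIntegral_const_mul T (-1) (fun x => ⟪grad u, v x⟫)
    rw [boundaryIntegral_congr (g := fun e x => u x * ⟪v x, outwardNormal T e⟫)
      (fun e he x hx => by rw [hm e he x hx]), ← h1]
    simp only [AffineMap.const_apply, inner_neg_left, neg_one_mul] at h2 ⊢
    rw [h2]; ring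
  · intro w
    have h1 := integral_by_parts hT w (AffineMap.const ℝ Plane (-grad u))
    have hdiv : divergence (AffineMap.const ℝ Plane (-grad u)) = 0 := by simp [divergence]
    simp_rw [hdiv, mul_zero, add_zero] at h1
    rw [boundaryIntegral_congr (g := fun e x => w x *
      ⟪(AffineMap.const ℝ Plane (-grad u)) x, outwardNormal T e⟫)
      (fun e he x hx => by rw [hm e he x hx, sub_self, mul_zero, add_zero, mul_comm]), ← h1]
    simp_rw [gradient_eq_grad, real_inner_comm (grad w)]
    exact neg_add_cancel _

/-! ### Local estimates on a shape regular triangle -/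

/-- `T` contains a disc of positive radius whose diameter is at least `diam T / σ`, the condition of
shape regularity for a single triangle. -/
def HasInscribedDisc (T : Finset Plane) (σ : ℝ) : Prop :=
  ∃ x : Plane, ∃ r : ℝ, 0 < r ∧ Metric.closedBall x r ⊆ hull T ∧
    Metric.diam (hull T) ≤ σ * (2 * r)

theorem diam_hull_nonneg (T : Finset Plane) : 0 ≤ Metric.diam (hull T) := Metric.diam_nonneg

theorem volumeReal_closedBall (x : Plane) {r : ℝ} (hr : 0 ≤ r) :
    volume.real (Metric.closedBall x r) = r ^ 2 * Real.pi := by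
  rw [Measure.real, EuclideanSpace.volume_closedBall_fin_two, ENNReal.toReal_mul,
    ENNReal.toReal_pow, ENNReal.toReal_ofReal hr, ENNReal.toReal_ofReal Real.pi_pos.le]

theorem volume_hull_ne_top (T : Finset Plane) : volume (hull T) ≠ ⊤ :=
  (isCompact_hull T).measure_lt_top.ne

theorem sq_diam_le_volume {T : Finset Plane} {σ : ℝ} (h : HasInscribedDisc T σ) :
    Metric.diam (hull T) ^ 2 * Real.pi ≤ 4 * σ ^ 2 * volume.real (hull T) := by
  obtain ⟨x, r, hr, hsub, hd⟩ := h
  have h1 := measureReal_mono hsub (volume_hull_ne_top T)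
  rw [volumeReal_closedBall x hr.le] at h1
  have h2 := pow_le_pow_left₀ (diam_hull_nonneg T) hd 2
  have h3 := mul_le_mul_of_nonneg_right h2 Real.pi_pos.le
  have h4 := mul_le_mul_of_nonneg_left h1 (by positivity : 0 ≤ 4 * σ ^ 2)
  linarith

theorem volume_hull_le_sq_diam {T : Finset Plane} (hT : T.Nonempty) :
    volume.real (hull T) ≤ Metric.diam (hull T) ^ 2 * Real.pi := by
  obtain ⟨z, hz⟩ := hT
  rw [← volumeReal_closedBall z (diam_hull_nonneg T)]
  refine measureReal_mono (fun y hy => ?_) measure_closedBall_lt_top.ne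
  exact Metric.dist_le_diam_of_mem (isCompact_hull T).isBounded hy
    (subset_convexHull ℝ _ hz)

theorem norm_sub_le_diam {T : Finset Plane} {a b : Plane} (ha : a ∈ T) (hb : b ∈ T) :
    ‖a - b‖ ≤ Metric.diam (hull T) := by
  rw [← dist_eq_norm]
  exact Metric.dist_le_diam_of_mem (isCompact_hull T).isBounded
    (subset_convexHull ℝ _ ha) (subset_convexHull ℝ _ hb)

theorem affine_le_of_vertices {T : Finset Plane} {u : ScalarP1} {c : ℝ} (h : ∀ z ∈ T, u z ≤ c)
    {x : Plane} (hx : x ∈ hull T) : u x ≤ c := by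
  have hconv : Convex ℝ {y : Plane | u y ≤ c} := by
    intro y hy z hz α β hα hβ hαβ
    have hy' : u y ≤ c := hy
    have hz' : u z ≤ c := hz
    change u (α • y + β • z) ≤ c
    rw [Convex.combo_affine_apply hαβ, smul_eq_mul, smul_eq_mul]
    obtain rfl : α = 1 - β := by linarith
    nlinarith
  exact convexHull_min (fun z hz => h z hz) hconv hx

/-- The oscillation of an affine function on the inscribed disc is at most that of its vertex
values. -/
theorem norm_grad_mul_le {T : Finset Plane} {σ δ : ℝ} (hT : T.Nonempty) (h : HasInscribedDisc T σ)
    {u : ScalarP1} (hu : ∀ z ∈ T, ∀ a ∈ T, |u z - u a| ≤ δ) :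
    ‖grad u‖ * Metric.diam (hull T) ≤ |σ| * δ := by
  obtain ⟨x, r, hr, hsub, hd⟩ := h
  obtain ⟨z₀, hz₀⟩ := hT
  have hδ : 0 ≤ δ := (abs_nonneg _).trans (hu z₀ hz₀ z₀ hz₀)
  have hosc : ∀ y ∈ hull T, ∀ y' ∈ hull T, u y - u y' ≤ δ := by
    intro y hy y' hy'
    have h1 : ∀ z ∈ T, u y ≤ u z + δ := fun z hz =>
      affine_le_of_vertices (fun a ha => by linarith [(abs_le.1 (hu a ha z hz)).2]) hy
    have h2 : (-u) y' ≤ δ - u y :=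
      affine_le_of_vertices (fun z hz => by
        have := h1 z hz
        change -(u z) ≤ _
        linarith) hy'
    have h3 : (-u) y' = -(u y') := rfl
    linarith
  have hg : ‖grad u‖ * (2 * r) ≤ δ := by
    rcases eq_or_ne (grad u) 0 with h0 | h0
    · rw [h0, norm_zero, zero_mul]; exact hδ
    · have hn : 0 < ‖grad u‖ := norm_pos_iff.2 h0
      set e : Plane := (r / ‖grad u‖) • grad u with he
      have hen : ‖e‖ = r := by
        rw [he, norm_smul, Real.norm_of_nonneg (by positivity)]
        field_simp
      have h1 := hosc (x + e) (hsub (by simp [hen])) (x - e) (hsub (by simp [hen]))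
      rw [affine_sub_eq] at h1
      have h2 : x + e - (x - e) = (2 : ℝ) • e := by rw [two_smul]; abel
      rw [h2, inner_smul_right, he, inner_smul_right, real_inner_self_eq_norm_sq] at h1
      have h3 : 2 * (r / ‖grad u‖ * ‖grad u‖ ^ 2) = ‖grad u‖ * (2 * r) := by field_simp
      linarith
  calc ‖grad u‖ * Metric.diam (hull T) ≤ ‖grad u‖ * (|σ| * (2 * r)) := by
        refine mul_le_mul_of_nonneg_left (hd.trans ?_) (norm_nonneg _)
        exact mul_le_mul_of_nonneg_right (le_abs_self σ) (by positivity)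
    _ = |σ| * (‖grad u‖ * (2 * r)) := by ring
    _ ≤ |σ| * δ := mul_le_mul_of_nonneg_left hg (abs_nonneg σ)

/-- The Dirichlet energy of an affine function is bounded by its vertex differences. -/
theorem sq_norm_grad_mul_volume_le {T : Finset Plane} {σ δ : ℝ} (hT : T.Nonempty)
    (h : HasInscribedDisc T σ) {u : ScalarP1} (hu : ∀ z ∈ T, ∀ a ∈ T, |u z - u a| ≤ δ) :
    ‖grad u‖ ^ 2 * volume.real (hull T) ≤ Real.pi * σ ^ 2 * δ ^ 2 := by
  have h1 := norm_grad_mul_le hT h hu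
  have h2 := pow_le_pow_left₀ (mul_nonneg (norm_nonneg _) (diam_hull_nonneg T)) h1 2
  have h3 := mul_le_mul_of_nonneg_left (volume_hull_le_sq_diam hT) (sq_nonneg ‖grad u‖)
  have h4 := mul_le_mul_of_nonneg_right h2 Real.pi_pos.le
  rw [mul_pow, mul_pow, sq_abs] at h4
  linarith

/-- The squared norm of the flux component of the local solution. -/
noncomputable def fluxEnergy (τ : ℝ) (T : Finset Plane) (m : Finset Plane → Plane → ℝ) : ℝ :=
  triangleIntegral T (fun x => ⟪(localSolution τ T m).1 x, (localSolution τ T m).1 x⟫)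

theorem fluxEnergy_nonneg (τ : ℝ) (T : Finset Plane) (m : Finset Plane → Plane → ℝ) :
    0 ≤ fluxEnergy τ T m :=
  triangleIntegral_nonneg T fun _ => real_inner_self_nonneg

/-- The scalar function with the value `α` at the first vertex and `β` at the other two. -/
theorem exists_affine_values {z a b : Plane} (h : IsTriangle {z, a, b}) (α β : ℝ) :
    ∃ q : ScalarP1, q z = α ∧ q a = β ∧ q b = β := by
  classical
  obtain ⟨hza, hzb, hab⟩ := h.ne
  obtain ⟨q, hq⟩ := exists_interpolant h.card_eq h.indep (fun x => if x = z then α else β)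
  refine ⟨q, ?_, ?_, ?_⟩
  · rw [hq z (by simp), if_pos rfl]
  · rw [hq a (by simp), if_neg hza.symm]
  · rw [hq b (by simp), if_neg hzb.symm]

/-- The flux equation tested with the divergence free field `q (b - a)`, where `q` is affine with
the value `α` at `z` and `β` at `a` and `b`.  As the divergence vanishes, only the flux component
of the local solution remains; the stabilization parameter does not enter. -/
theorem sq_test_le_fluxEnergy {z a b : Plane} (h : IsTriangle {z, a, b}) {σ τ : ℝ}
    (hτ : 0 < τ) (hσ : HasInscribedDisc {z, a, b} σ) {m : Finset Plane → Plane → ℝ}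
    {p : Finset Plane → ScalarP1}
    (hp : ∀ e ∈ triangleEdges {z, a, b}, ∀ x ∈ hull e, m e x = p e x) {α β : ℝ} (hα : |α| ≤ 2)
    (hβ : |β| ≤ 2) :
    ((2 * p {b, z} b * β + p {b, z} b * α + p {b, z} z * β + 2 * p {b, z} z * α)
      - (2 * p {z, a} z * α + p {z, a} z * β + p {z, a} a * α + 2 * p {z, a} a * β)) ^ 2
      ≤ 144 * σ ^ 2 * fluxEnergy τ {z, a, b} m := by
  obtain ⟨q, hqz, hqa, hqb⟩ := exists_affine_values h α β
  have hD := h.cross_ne_zero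
  let v : VectorP1 := (LinearMap.toSpanSingleton ℝ Plane (b - a)).toAffineMap.comp q
  have hv : ∀ x, v x = q x • (b - a) := fun x => by simp [v]
  have hdiv : divergence v = 0 := by
    have e : v.linear = q.linear.smulRight (b - a) := by
      ext x; simp [v]
    have e2 := q.linearMap_vsub b a
    simp only [vsub_eq_sub] at e2
    rw [divergence, e, LinearMap.trace_smulRight, e2, hqa, hqb, sub_self]
  have hsol := localSolution_spec h hτ (fun e he => ⟨p e, hp e he⟩)
  have hflux := hsol.flux v
  rw [boundaryIntegral_congr (g := fun e x => p e x * ⟪v x, outwardNormal {z, a, b} e⟫)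
    (fun e he x hx => by rw [hp e he x hx]), boundaryIntegral_flux h, hdiv] at hflux
  simp only [mul_zero, hv, hqz, hqa, hqb] at hflux
  have h0 : triangleIntegral {z, a, b} (fun _ => (0 : ℝ)) = 0 := by simp [triangleIntegral]
  have hcs := triangleIntegral_inner_sq_le {z, a, b} (localSolution τ {z, a, b} m).1 v
  rw [h0, sub_zero] at hflux
  simp only [hv] at hcs
  rw [hflux] at hcs
  have hvv : triangleIntegral {z, a, b} (fun x => ⟪q x • (b - a), q x • (b - a)⟫)
      ≤ 4 * ‖b - a‖ ^ 2 * volume.real (hull {z, a, b}) := by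
    have hle : ∀ x ∈ hull {z, a, b}, ⟪q x • (b - a), q x • (b - a)⟫ ≤ 4 * ‖b - a‖ ^ 2 := by
      intro x hx
      have h1 : q x ≤ 2 := affine_le_of_vertices (by
        intro y hy
        simp only [Finset.mem_insert, Finset.mem_singleton] at hy
        rcases hy with rfl | rfl | rfl
        · rw [hqz]; exact (abs_le.1 hα).2
        · rw [hqa]; exact (abs_le.1 hβ).2
        · rw [hqb]; exact (abs_le.1 hβ).2) hx
      have h2 : (-q) x ≤ 2 := affine_le_of_vertices (by
        intro y hy
        change -(q y) ≤ 2
        simp only [Finset.mem_insert, Finset.mem_singleton] at hy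
        rcases hy with rfl | rfl | rfl
        · rw [hqz]; linarith [(abs_le.1 hα).1]
        · rw [hqa]; linarith [(abs_le.1 hβ).1]
        · rw [hqb]; linarith [(abs_le.1 hβ).1]) hx
      have h3 : -(q x) ≤ 2 := h2
      rw [inner_smul_left, inner_smul_right, real_inner_self_eq_norm_sq, conj_trivial, ← mul_assoc]
      exact mul_le_mul_of_nonneg_right (by nlinarith) (sq_nonneg _)
    have hqc := continuous_scalarP1 q
    calc triangleIntegral {z, a, b} (fun x => ⟪q x • (b - a), q x • (b - a)⟫)
        ≤ ∫ _ in hull {z, a, b}, 4 * ‖b - a‖ ^ 2 :=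
          setIntegral_mono_on (integrableOn_hull (by fun_prop)) (integrableOn_hull (by fun_prop))
            (measurableSet_hull _) hle
      _ = _ := by
          rw [integral_const, measureReal_restrict_apply_univ, smul_eq_mul, mul_comm]
  have hba : ‖b - a‖ ^ 2 * Real.pi ≤ 4 * σ ^ 2 * volume.real (hull {z, a, b}) := by
    refine le_trans (mul_le_mul_of_nonneg_right ?_ Real.pi_pos.le) (sq_diam_le_volume hσ)
    exact pow_le_pow_left₀ (norm_nonneg _) (norm_sub_le_diam (by simp) (by simp)) 2
  have hE := fluxEnergy_nonneg τ {z, a, b} m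
  have hvol := volume_hull_triple z a b hD
  set V := volume.real (hull {z, a, b}) with hV
  have hVpos : 0 < V := by rw [hvol]; positivity
  have habs : |cross (a - z) (b - z)|
      = cross (a - z) (b - z) / |cross (a - z) (b - z)| * cross (a - z) (b - z) := by
    have := abs_pos.2 hD
    field_simp
    rw [sq_abs]
  set s := cross (a - z) (b - z) / |cross (a - z) (b - z)| with hs
  have hV2 : s * cross (a - z) (b - z) = 2 * V := by rw [← habs, hvol]; ring
  set X := (2 * p {b, z} b * β + p {b, z} b * α + p {b, z} z * β + 2 * p {b, z} z * α)
      - (2 * p {z, a} z * α + p {z, a} z * β + p {z, a} a * α + 2 * p {z, a} a * β) with hX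
  have hX2 : (V / 3 * X) ^ 2 ≤ fluxEnergy τ {z, a, b} m * (4 * ‖b - a‖ ^ 2 * V) := by
    refine le_trans (le_of_eq ?_) (hcs.trans (mul_le_mul_of_nonneg_left hvv hE))
    have : V / 3 * X = s * cross (a - z) (b - z) / 6 * X := by rw [hV2]; ring
    rw [this, neg_sq]
    congr 1
    rw [hX]
    simp only [cross, PiLp.sub_apply, PiLp.smul_apply, smul_eq_mul]
    ring
  have hpi : 1 ≤ Real.pi := by linarith [Real.pi_gt_three]
  have hba' : ‖b - a‖ ^ 2 ≤ 4 * σ ^ 2 * V :=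
    le_trans (le_mul_of_one_le_right (sq_nonneg _) hpi) hba
  have h5 : V ^ 2 * X ^ 2 ≤ V ^ 2 * (144 * σ ^ 2 * fluxEnergy τ {z, a, b} m) := by
    have h6 := mul_le_mul_of_nonneg_left hba'
      (by positivity : 0 ≤ fluxEnergy τ {z, a, b} m * (36 * V))
    linear_combination 9 * hX2 + h6
  exact le_of_mul_le_mul_left h5 (by positivity)

/-- The jump at a vertex between two edges of a triangle is controlled by the flux. -/
theorem abs_jump_le_sqrt_fluxEnergy {z a b : Plane} (h : IsTriangle {z, a, b}) {σ τ : ℝ}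
    (hτ : 0 < τ) (hσ : HasInscribedDisc {z, a, b} σ) {m : Finset Plane → Plane → ℝ}
    {p : Finset Plane → ScalarP1}
    (hp : ∀ e ∈ triangleEdges {z, a, b}, ∀ x ∈ hull e, m e x = p e x) :
    |p {z, a} z - p {z, b} z| ≤ √(16 * σ ^ 2 * fluxEnergy τ {z, a, b} m) := by
  apply Real.abs_le_sqrt
  have h1 := sq_test_le_fluxEnergy h hτ hσ hp (α := -2) (β := 1) (by norm_num) (by norm_num)
  rw [Finset.pair_comm b z] at h1
  linear_combination h1 / 9

/-- The variation along an edge of a triangle is controlled by the flux.  It is the sum of the jumps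
at the three vertices and of twice the difference of the mean values on the other two edges. -/
theorem abs_variation_le_sqrt_fluxEnergy {z a b : Plane} (h : IsTriangle {z, a, b}) {σ τ : ℝ}
    (hτ : 0 < τ) (hσ : HasInscribedDisc {z, a, b} σ) {m : Finset Plane → Plane → ℝ}
    {p : Finset Plane → ScalarP1}
    (hp : ∀ e ∈ triangleEdges {z, a, b}, ∀ x ∈ hull e, m e x = p e x) :
    |p {z, a} z - p {z, a} a| ≤ 4 * √(16 * σ ^ 2 * fluxEnergy τ {z, a, b} m) := by
  have r1 := insert_rotate z a b
  have r2 := insert_rotate a b z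
  have h2 : IsTriangle {a, b, z} := r1 ▸ h
  have h3 : IsTriangle {b, z, a} := r2 ▸ h2
  have j1 := abs_jump_le_sqrt_fluxEnergy h hτ hσ hp
  have j2 := abs_jump_le_sqrt_fluxEnergy h2 hτ (r1 ▸ hσ) (m := m) (p := p) (r1 ▸ hp)
  have j3 := abs_jump_le_sqrt_fluxEnergy h3 hτ (r2 ▸ r1 ▸ hσ) (m := m) (p := p) (r2 ▸ r1 ▸ hp)
  have k := sq_test_le_fluxEnergy h3 hτ (r2 ▸ r1 ▸ hσ) (m := m) (p := p) (r2 ▸ r1 ▸ hp)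
    (α := 1) (β := 1) (by norm_num) (by norm_num)
  rw [← r2, ← r1] at j3 k
  rw [← r1] at j2
  rw [Finset.pair_comm b z, Finset.pair_comm b a] at j3
  rw [Finset.pair_comm b z] at k
  rw [Finset.pair_comm a z] at j2
  have k' : |p {a, b} a + p {a, b} b - (p {z, b} b + p {z, b} z)|
      ≤ √(16 * σ ^ 2 * fluxEnergy τ {z, a, b} m) := by
    apply Real.abs_le_sqrt
    linear_combination k / 9
  rw [abs_le] at *
  constructor <;> linarith [j1.1, j1.2, j2.1, j2.2, j3.1, j3.2, k'.1, k'.2]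

/-! ### Meshes -/

namespace Triangulation

variable {Ω : Set Plane} (𝒯 : Triangulation Ω)

theorem mem_triangles {T : Finset Plane} :
    T ∈ 𝒯.triangles ↔ T ∈ 𝒯.complex.faces ∧ T.card = 3 := by
  simp [triangles]

theorem mem_edges {e : Finset Plane} : e ∈ 𝒯.edges ↔ e ∈ 𝒯.complex.faces ∧ e.card = 2 := by
  simp [edges]

theorem mem_edgesAt {e : Finset Plane} {z : Plane} : e ∈ 𝒯.edgesAt z ↔ e ∈ 𝒯.edges ∧ z ∈ e := by
  simp [edgesAt]

variable {𝒯}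

theorem isTriangle {T : Finset Plane} (hT : T ∈ 𝒯.triangles) : IsTriangle T :=
  ⟨(𝒯.mem_triangles.1 hT).2, 𝒯.complex.indep (𝒯.mem_triangles.1 hT).1⟩

theorem mem_edges_of_triangle {T e : Finset Plane} (hT : T ∈ 𝒯.triangles)
    (he : e ∈ triangleEdges T) : e ∈ 𝒯.edges := by
  obtain ⟨hsub, hc⟩ := Finset.mem_powersetCard.1 he
  exact 𝒯.mem_edges.2 ⟨𝒯.complex.down_closed (𝒯.mem_triangles.1 hT).1 hsub
    (Finset.card_pos.1 (by omega)), hc⟩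

theorem exists_triangle_of_edge {e : Finset Plane} (he : e ∈ 𝒯.edges) :
    ∃ T ∈ 𝒯.triangles, e ∈ triangleEdges T := by
  obtain ⟨hf, hc⟩ := 𝒯.mem_edges.1 he
  obtain ⟨T, hT, hs, hT3⟩ := 𝒯.pure e hf
  exact ⟨T, 𝒯.mem_triangles.2 ⟨hT, hT3⟩, Finset.mem_powersetCard.2 ⟨hs, hc⟩⟩

theorem mem_closure_iff {x : Plane} : x ∈ closure Ω ↔ ∃ T ∈ 𝒯.triangles, x ∈ hull T := by
  rw [← 𝒯.cover, Geometry.SimplicialComplex.mem_space_iff]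
  constructor
  · rintro ⟨s, hs, hx⟩
    obtain ⟨T, hT, hsT, hT3⟩ := 𝒯.pure s hs
    exact ⟨T, 𝒯.mem_triangles.2 ⟨hT, hT3⟩, convexHull_mono (by exact_mod_cast hsT) hx⟩
  · rintro ⟨T, hT, hx⟩
    exact ⟨T, (𝒯.mem_triangles.1 hT).1, hx⟩

theorem hull_inter_subset {s t : Finset Plane} (hs : s ∈ 𝒯.complex.faces)
    (ht : t ∈ 𝒯.complex.faces) {x : Plane} (hxs : x ∈ hull s) (hxt : x ∈ hull t) :
    x ∈ hull (s ∩ t) := by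
  have := 𝒯.complex.inter_subset_convexHull hs ht ⟨hxs, hxt⟩
  rwa [hull, Finset.coe_inter]

theorem volume_hull_of_card_le_two {s : Finset Plane} (hs : s.card ≤ 2) :
    volume (hull s) = 0 := by
  rcases s.eq_empty_or_nonempty with rfl | hne
  · simp [hull]
  refine measure_mono_null (convexHull_subset_affineSpan _) (Measure.addHaar_affineSubspace _ _ ?_)
  intro htop
  have h2 : (vectorSpan ℝ (s : Set Plane)) = ⊤ := by
    rw [← direction_affineSpan, htop, AffineSubspace.direction_top]
  have h3 := finrank_vectorSpan_range_le ℝ ((↑) : s → Plane)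
    (n := s.card - 1) (by have := Finset.card_pos.2 hne; simp; omega)
  have h4 : Set.range ((↑) : s → Plane) = (s : Set Plane) := by simp
  rw [h4, h2, finrank_top, finrank_euclideanSpace_fin] at h3
  omega

theorem volume_inter_eq_zero {T T' : Finset Plane} (hT : T ∈ 𝒯.triangles) (hT' : T' ∈ 𝒯.triangles)
    (hne : T ≠ T') : volume (hull T ∩ hull T') = 0 := by
  obtain ⟨hf, hc⟩ := 𝒯.mem_triangles.1 hT
  obtain ⟨hf', hc'⟩ := 𝒯.mem_triangles.1 hT'
  refine measure_mono_null (fun x hx => hull_inter_subset hf hf' hx.1 hx.2)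
    (volume_hull_of_card_le_two ?_)
  by_contra hlt
  have h1 : T ∩ T' = T := Finset.eq_of_subset_of_card_le Finset.inter_subset_left (by omega)
  have h2 : T ∩ T' = T' := Finset.eq_of_subset_of_card_le Finset.inter_subset_right (by omega)
  exact hne (h1.symm.trans h2)

/-- The triangles of a mesh do not overlap. -/
theorem sum_volume_le {S : Finset (Finset Plane)} (hS : S ⊆ 𝒯.triangles) {A : Set Plane}
    (hA : ∀ T ∈ S, hull T ⊆ A) (hAtop : volume A ≠ ⊤) :
    ∑ T ∈ S, volume.real (hull T) ≤ volume.real A := by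
  rw [← measureReal_biUnion_finset₀ (μ := volume) (s := S) (f := hull)
    (fun T hT T' hT' hne => volume_inter_eq_zero (hS hT) (hS hT') hne)
    (fun T _ => (measurableSet_hull T).nullMeasurableSet)
    (fun T _ => volume_hull_ne_top T)]
  exact measureReal_mono (Set.iUnion₂_subset hA) hAtop

theorem diam_le_meshSize {T : Finset Plane} (hT : T ∈ 𝒯.triangles) :
    Metric.diam (hull T) ≤ 𝒯.meshSize :=
  le_csSup ((𝒯.triangles.finite_toSet.image _).bddAbove) ⟨T, hT, rfl⟩

open scoped Classical in
/-- The triangles that contain the point `z` as a vertex. -/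
noncomputable def trianglesAt (𝒯 : Triangulation Ω) (z : Plane) : Finset (Finset Plane) :=
  𝒯.triangles.filter fun T => z ∈ T

theorem mem_trianglesAt {T : Finset Plane} {z : Plane} :
    T ∈ 𝒯.trianglesAt z ↔ T ∈ 𝒯.triangles ∧ z ∈ T := by
  simp [trianglesAt]

/-- The triangles at a vertex have an area comparable with `h ^ 2` and lie in a disc of radius `h`,
so their number is bounded. -/
theorem card_trianglesAt_le {σ ρ : ℝ} (hσ : 𝒯.ShapeRegular σ) (hρ : 𝒯.QuasiUniform ρ) (z : Plane) :
    ((𝒯.trianglesAt z).card : ℝ) ≤ 4 * σ ^ 2 * ρ ^ 2 := by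
  rcases (𝒯.trianglesAt z).eq_empty_or_nonempty with h0 | ⟨T₀, hT₀⟩
  · rw [h0]; simp; positivity
  have hpi := Real.pi_pos
  have hpos : 0 < 𝒯.meshSize := by
    obtain ⟨x, r, hr, hsub, hd⟩ := hσ T₀ (mem_trianglesAt.1 hT₀).1
    have h1 := measureReal_mono hsub (volume_hull_ne_top T₀)
    rw [volumeReal_closedBall x hr.le] at h1
    have h2 := volume_hull_le_sq_diam ⟨z, (mem_trianglesAt.1 hT₀).2⟩
    have h3 : 0 < Metric.diam (hull T₀) := by
      refine lt_of_le_of_ne (diam_hull_nonneg T₀) fun h => ?_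
      rw [← h] at h2
      have : 0 < r ^ 2 * Real.pi := by positivity
      linarith
    exact h3.trans_le (diam_le_meshSize (mem_trianglesAt.1 hT₀).1)
  set h := 𝒯.meshSize with hh
  have hsum : ∑ T ∈ 𝒯.trianglesAt z, volume.real (hull T) ≤ h ^ 2 * Real.pi := by
    rw [← volumeReal_closedBall z hpos.le]
    refine sum_volume_le (Finset.filter_subset _ _) (fun T hT y hy => ?_)
      measure_closedBall_lt_top.ne
    obtain ⟨hT, hz⟩ := mem_trianglesAt.1 hT
    exact (Metric.dist_le_diam_of_mem (isCompact_hull T).isBounded hy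
      (subset_convexHull ℝ _ hz)).trans (diam_le_meshSize hT)
  have hlow : ∀ T ∈ 𝒯.trianglesAt z,
      h ^ 2 * Real.pi ≤ 4 * σ ^ 2 * ρ ^ 2 * volume.real (hull T) := by
    intro T hT
    obtain ⟨hT, hz⟩ := mem_trianglesAt.1 hT
    have h1 := sq_diam_le_volume (hσ T hT)
    have h2 := pow_le_pow_left₀ hpos.le (hρ T hT) 2
    rw [mul_pow] at h2
    have h3 := mul_le_mul_of_nonneg_right h2 hpi.le
    have h4 := mul_le_mul_of_nonneg_left h1 (sq_nonneg ρ)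
    linarith
  have h5 := Finset.card_nsmul_le_sum _ _ _ hlow
  rw [← Finset.mul_sum, nsmul_eq_mul] at h5
  have h6 := mul_le_mul_of_nonneg_left hsum (by positivity : 0 ≤ 4 * σ ^ 2 * ρ ^ 2)
  exact le_of_mul_le_mul_right (h5.trans h6) (by positivity)

theorem card_edgesAt_le {σ ρ : ℝ} (hσ : 𝒯.ShapeRegular σ) (hρ : 𝒯.QuasiUniform ρ) (z : Plane) :
    ((𝒯.edgesAt z).card : ℝ) ≤ 12 * σ ^ 2 * ρ ^ 2 := by
  classical
  have h1 : 𝒯.edgesAt z ⊆ (𝒯.trianglesAt z).biUnion triangleEdges := by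
    intro e he
    obtain ⟨he, hz⟩ := 𝒯.mem_edgesAt.1 he
    obtain ⟨T, hT, heT⟩ := exists_triangle_of_edge he
    exact Finset.mem_biUnion.2
      ⟨T, mem_trianglesAt.2 ⟨hT, (Finset.mem_powersetCard.1 heT).1 hz⟩, heT⟩
  have h2 := (Finset.card_le_card h1).trans (Finset.card_biUnion_le_card_mul _ _ 3 fun T hT => by
    rw [triangleEdges, Finset.card_powersetCard, (isTriangle (mem_trianglesAt.1 hT).1).card_eq]
    decide)
  have h3 : ((𝒯.edgesAt z).card : ℝ) ≤ (𝒯.trianglesAt z).card * 3 := by exact_mod_cast h2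
  have h4 := card_trianglesAt_le hσ hρ z
  linarith

end Triangulation

/-! ### The fan of triangles at a vertex -/

theorem continuous_cross_left (w : Plane) : Continuous fun y => cross y w := by
  unfold cross; fun_prop

theorem continuous_cross_right (u : Plane) : Continuous fun y => cross u y := by
  unfold cross; fun_prop

@[simp] theorem cross_self (u : Plane) : cross u u = 0 := by simp [cross]; ring

/-- The cone of the nonnegative combinations of two independent vectors, in terms of the
coordinates given by Cramer's rule. -/
def cone (u w : Plane) : Set Plane := {y | 0 ≤ cross y w / cross u w ∧ 0 ≤ cross u y / cross u w}

theorem isClosed_cone (u w : Plane) : IsClosed (cone u w) :=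
  (isClosed_le continuous_const ((continuous_cross_left w).div_const _)).inter
    (isClosed_le continuous_const ((continuous_cross_right u).div_const _))

theorem eq_combination {u w : Plane} (h : cross u w ≠ 0) (y : Plane) :
    y = (cross y w / cross u w) • u + (cross u y / cross u w) • w := by
  have h1 := cross_smul_eq u w y
  have h2 : y = (cross u w)⁻¹ • (cross u w • y) := by rw [smul_smul, inv_mul_cancel₀ h, one_smul]
  conv_lhs => rw [h2, h1, smul_add, smul_smul, smul_smul]
  rw [div_eq_inv_mul, div_eq_inv_mul]

/-- The cones on the two sides of a common ray cover a neighbourhood of a point of the ray. -/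
theorem cone_union_cone_mem_nhds {u w w' y : Plane} (h : cross u w' * cross u w < 0)
    (h1 : 0 < cross y w / cross u w) (h0 : cross u y = 0) :
    cone u w ∪ cone u w' ∈ nhds y := by
  have hw : cross u w ≠ 0 := fun e => by simp [e] at h
  have hw' : cross u w' ≠ 0 := fun e => by simp [e] at h
  have hy := eq_combination hw y
  rw [h0, zero_div, zero_smul, add_zero] at hy
  have h2 : 0 < cross y w' / cross u w' := by
    set t := cross y w / cross u w
    rw [hy]
    have : cross (t • u) w' = t * cross u w' := by simp [cross]; ring
    rw [this, mul_div_assoc, div_self hw', mul_one]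
    exact h1
  filter_upwards
    [(((continuous_cross_left w).div_const _).isOpen_preimage _ isOpen_Ioi).mem_nhds h1,
    (((continuous_cross_left w').div_const _).isOpen_preimage _ isOpen_Ioi).mem_nhds h2]
    with x hx hx'
  have hx1 : 0 < cross x w / cross u w := hx
  have hx2 : 0 < cross x w' / cross u w' := hx'
  rcases le_or_gt 0 (cross u x / cross u w) with hc | hc
  · exact Or.inl ⟨hx1.le, hc⟩
  · refine Or.inr ⟨hx2.le, ?_⟩
    have e : cross u x / cross u w' = cross u x / cross u w * (cross u w / cross u w') := by
      field_simp
    have : cross u w / cross u w' < 0 := by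
      rw [div_neg_iff]
      rcases lt_or_gt_of_ne hw with h3 | h3
      · exact Or.inr ⟨h3, by nlinarith⟩
      · exact Or.inl ⟨h3, by nlinarith⟩
    rw [e]
    exact (mul_pos_of_neg_of_neg hc this).le

theorem exists_eq_pair {f : Finset Plane} {z : Plane} (hf : f.card = 2) (hz : z ∈ f) :
    ∃ a, a ≠ z ∧ f = {z, a} := by
  obtain ⟨x, y, hxy, rfl⟩ := Finset.card_eq_two.1 hf
  simp only [Finset.mem_insert, Finset.mem_singleton] at hz
  rcases hz with rfl | rfl
  · exact ⟨y, hxy.symm, rfl⟩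
  · exact ⟨x, hxy, Finset.pair_comm _ _⟩

theorem exists_eq_triple {T : Finset Plane} {z a : Plane} (hT : T.card = 3) (ha : a ≠ z)
    (hsub : {z, a} ⊆ T) : ∃ b, T = {z, a, b} := by
  obtain ⟨b, hb⟩ : ∃ b, T \ {z, a} = {b} := by
    rw [← Finset.card_eq_one, Finset.card_sdiff_of_subset hsub, hT, Finset.card_pair ha.symm]
  refine ⟨b, ?_⟩
  rw [← Finset.sdiff_union_of_subset hsub, hb]
  ext y; simp only [Finset.mem_union, Finset.mem_insert, Finset.mem_singleton]; tauto

namespace Triangulation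

variable {Ω : Set Plane} {𝒯 : Triangulation Ω}

theorem isTriangle_insert {z a b : Plane} (h : {z, a, b} ∈ 𝒯.triangles) :
    cross (a - z) (b - z) ≠ 0 := (isTriangle h).cross_ne_zero

/-- An edge that is not contained in the frontier of `Ω` has a triangle on each side. -/
theorem exists_opposite_triangle (hΩ : IsOpen Ω) {z a b : Plane} (hT : {z, a, b} ∈ 𝒯.triangles)
    (hfr : ¬ hull {z, a} ⊆ frontier Ω) :
    ∃ c, {z, a, c} ∈ 𝒯.triangles ∧ cross (a - z) (c - z) * cross (a - z) (b - z) < 0 := by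
  obtain ⟨hza, hzb, hab⟩ := (isTriangle hT).ne
  have hD := isTriangle_insert hT
  have he : {z, a} ∈ 𝒯.edges := mem_edges_of_triangle hT
    (by rw [triangleEdges_triple (isTriangle hT)]; simp)
  obtain ⟨x, hx, hxfr⟩ := Set.not_subset.1 hfr
  have hxcl : x ∈ closure Ω :=
    𝒯.mem_closure_iff.2 ⟨_, hT, convexHull_mono (by intro y; simp; tauto) hx⟩
  have hxΩ : x ∈ Ω := by
    by_contra hn
    exact hxfr ⟨hxcl, by rwa [hΩ.interior_eq]⟩
  -- `Ω` is open, so that `x` may be moved into the relative interior of the edge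
  obtain ⟨t₀, h0, h1, rfl⟩ := mem_hull_pair.1 hx
  have hopen : IsOpen {t : ℝ | z + t • (a - z) ∈ Ω} := hΩ.preimage (by fun_prop)
  obtain ⟨t, htΩ, ht0, ht1⟩ : ∃ t : ℝ, z + t • (a - z) ∈ Ω ∧ 0 < t ∧ t < 1 := by
    have hcl : t₀ ∈ closure (Set.Ioo (0 : ℝ) 1) := by
      rw [closure_Ioo zero_ne_one]; exact ⟨h0, h1⟩
    obtain ⟨t, h2, h3⟩ := mem_closure_iff_nhds.1 hcl _ (hopen.mem_nhds hxΩ)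
    exact ⟨t, h2, h3.1, h3.2⟩
  set x' := z + t • (a - z) with hx'
  -- one triangle contains points beyond the edge that are arbitrarily close to `x'`
  have hcont : Continuous fun s : ℝ => x' - s • (b - z) := by fun_prop
  have hlim : Filter.Tendsto (fun s : ℝ => x' - s • (b - z)) (nhdsWithin 0 (Set.Ioi 0))
      (nhds x') := by
    have := (hcont.tendsto 0).mono_left (nhdsWithin_le_nhds (s := Set.Ioi 0))
    simpa using this
  have hex : ∃ T ∈ 𝒯.triangles,
      ∃ᶠ s in nhdsWithin (0 : ℝ) (Set.Ioi 0), x' - s • (b - z) ∈ hull T := by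
    by_contra! hcon
    have hall := (Filter.eventually_all_finset 𝒯.triangles).2 hcon
    obtain ⟨s, hs, hsΩ⟩ := (hall.and (hlim.eventually (hΩ.mem_nhds htΩ))).exists
    obtain ⟨T, hT, hsT⟩ := 𝒯.mem_closure_iff.1 (subset_closure hsΩ)
    exact hs T hT hsT
  obtain ⟨T, hT', hfreq⟩ := hex
  have hx'T : x' ∈ hull T :=
    (isCompact_hull T).isClosed.mem_of_frequently_of_tendsto hfreq hlim
  have hx'e : x' ∈ hull {z, a} := mem_hull_pair.2 ⟨t, ht0.le, ht1.le, rfl⟩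
  have hxi := hull_inter_subset (𝒯.mem_edges.1 he).1 (𝒯.mem_triangles.1 hT').1 hx'e hx'T
  have haz : a - z ≠ 0 := sub_ne_zero.2 hza.symm
  have hsub : {z, a} ⊆ T := by
    by_contra hn
    rw [Finset.insert_subset_iff, Finset.singleton_subset_iff] at hn
    have : ∃ y, (y = z ∨ y = a) ∧ {z, a} ∩ T ⊆ {y} := by
      by_cases hzT : z ∈ T
      · refine ⟨z, Or.inl rfl, fun y hy => ?_⟩
        simp only [Finset.mem_inter, Finset.mem_insert, Finset.mem_singleton] at hy ⊢
        rcases hy with ⟨rfl | rfl, hy⟩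
        · rfl
        · exact absurd ⟨hzT, hy⟩ hn
      · refine ⟨a, Or.inr rfl, fun y hy => ?_⟩
        simp only [Finset.mem_inter, Finset.mem_insert, Finset.mem_singleton] at hy ⊢
        rcases hy with ⟨rfl | rfl, hy⟩
        · exact absurd hy hzT
        · rfl
    obtain ⟨y, hy, hys⟩ := this
    have hxy : x' ∈ hull {y} := convexHull_mono (by exact_mod_cast hys) hxi
    have hxy' : x' = y := by simpa [hull] using hxy
    rcases hy with rfl | rfl
    · rw [hx', add_eq_left, smul_eq_zero] at hxy'
      exact hxy'.elim ht0.ne' haz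
    · have h3 : (1 - t) • (y - z) = 0 := by
        have h4 : y - z = t • (y - z) := by
          conv_lhs => rw [← hxy', hx']
          abel
        rw [sub_smul, one_smul, ← h4, sub_self]
      rw [smul_eq_zero] at h3
      exact h3.elim (fun h => by linarith) haz
  have hcard := (isTriangle hT').card_eq
  obtain ⟨c, hTeq⟩ := exists_eq_triple hcard hza.symm hsub
  subst hTeq
  refine ⟨c, hT', ?_⟩
  obtain ⟨s, hs, hs0⟩ := (hfreq.and_eventually self_mem_nhdsWithin).exists
  have hs0' : (0 : ℝ) < s := hs0
  obtain ⟨α, γ, hα, hγ, -, hcomb⟩ := mem_hull_triple.1 hs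
  have hE : s * cross (a - z) (b - z) + γ * cross (a - z) (c - z) = 0 := by
    have h5 : γ • (c - z) = (t - α) • (a - z) - s • (b - z) := by
      have h6 : z + t • (a - z) - s • (b - z) = z + α • (a - z) + γ • (c - z) := hcomb
      have h7 : γ • (c - z) = (z + α • (a - z) + γ • (c - z)) - z - α • (a - z) := by abel
      rw [h7, ← h6, sub_smul]; abel
    have h8 := congrArg (cross (a - z)) h5
    simp only [cross, PiLp.smul_apply, PiLp.sub_apply, smul_eq_mul] at h8 ⊢
    linear_combination h8
  have hγ0 : γ ≠ 0 := by
    rintro rfl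
    rw [zero_mul, add_zero] at hE
    exact (mul_ne_zero hs0'.ne' hD) hE
  have hγpos : 0 < γ := lt_of_le_of_ne hγ hγ0.symm
  have hpos : 0 < s * cross (a - z) (b - z) ^ 2 := by positivity
  have : γ * (cross (a - z) (c - z) * cross (a - z) (b - z)) < 0 := by
    have e : γ * (cross (a - z) (c - z) * cross (a - z) (b - z))
        = -(s * cross (a - z) (b - z) ^ 2) := by
      linear_combination cross (a - z) (b - z) * hE
    linarith
  by_contra hn
  exact absurd this (not_lt.2 (mul_nonneg hγ (not_lt.1 hn)))

/-- The graph of the edges at `z`; two edges are adjacent if they are edges of one triangle. -/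
def fanGraph (𝒯 : Triangulation Ω) (z : Plane) : SimpleGraph (𝒯.edgesAt z) where
  Adj e e' := e ≠ e' ∧ ∃ T ∈ 𝒯.triangles, e.1 ⊆ T ∧ e'.1 ⊆ T
  symm := ⟨fun _ _ h => ⟨h.1.symm, h.2.imp fun _ h => ⟨h.1, h.2.2, h.2.1⟩⟩⟩
  loopless := ⟨fun _ h => h.1 rfl⟩

theorem pair_mem_edgesAt {z a b : Plane} (h : {z, a, b} ∈ 𝒯.triangles) : {z, a} ∈ 𝒯.edgesAt z :=
  𝒯.mem_edgesAt.2 ⟨mem_edges_of_triangle h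
    (by rw [triangleEdges_triple (isTriangle h)]; simp), by simp⟩

/-- An edge at `z` can be reached from any other one through triangles at `z`, unless an edge in the
frontier of `Ω` can be reached.  If no such edge can be reached, the union of the cones spanned at
`z` by the triangles reached is closed and, apart from the apex, open, so that it is the plane. -/
theorem reachable_or_exists_frontier (hΩ : IsOpen Ω) {z : Plane} (e e' : 𝒯.edgesAt z) :
    (𝒯.fanGraph z).Reachable e e' ∨
      ∃ f : 𝒯.edgesAt z, (𝒯.fanGraph z).Reachable e f ∧ hull f.1 ⊆ frontier Ω := by
  by_contra! hcon
  obtain ⟨hne, hfr⟩ := hcon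
  -- `R a`: the edge from `z` to `a` can be reached; `C`: the union of the cones of the triangles
  -- that contain such an edge
  let R : Plane → Prop := fun a =>
    ∃ h : {z, a} ∈ 𝒯.edgesAt z, (𝒯.fanGraph z).Reachable e ⟨{z, a}, h⟩
  have hRswap : ∀ {a b}, {z, a, b} ∈ 𝒯.triangles → R a → R b := by
    rintro a b hT ⟨h, hr⟩
    have hb : {z, b} ∈ 𝒯.edgesAt z := pair_mem_edgesAt (by rwa [insert_swap] at hT)
    refine ⟨hb, ?_⟩
    by_cases hab : (⟨{z, a}, h⟩ : 𝒯.edgesAt z) = ⟨{z, b}, hb⟩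
    · rw [← hab]; exact hr
    · refine hr.trans (SimpleGraph.Adj.reachable ⟨hab, _, hT, ?_, ?_⟩)
      · intro y; simp; tauto
      · intro y; simp; tauto
  let P : Set (Plane × Plane) := {q | {z, q.1, q.2} ∈ 𝒯.triangles ∧ R q.1}
  let C : Set Plane := ⋃ q ∈ P, cone (q.1 - z) (q.2 - z)
  have hCmem : ∀ {y}, y ∈ C ↔ ∃ a b, {z, a, b} ∈ 𝒯.triangles ∧ R a ∧ y ∈ cone (a - z) (b - z) := by
    intro y
    simp only [C, P, Set.mem_iUnion, Prod.exists, Set.mem_ofPred_eq, exists_prop, and_assoc]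
  have hPfin : P.Finite := by
    classical
    refine ((𝒯.triangles.biUnion id ×ˢ 𝒯.triangles.biUnion id).finite_toSet).subset ?_
    rintro ⟨a, b⟩ ⟨hT, -⟩
    simp only [Finset.coe_product, Set.mem_prod, Finset.mem_coe, Finset.mem_biUnion, id]
    exact ⟨⟨_, hT, by simp⟩, ⟨_, hT, by simp⟩⟩
  have hCcl : IsClosed C := hPfin.isClosed_biUnion fun q _ => isClosed_cone _ _
  -- near a point of a ray of the fan, the triangle beyond the ray completes a neighbourhood
  have hray : ∀ {a b y}, {z, a, b} ∈ 𝒯.triangles → R a →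
      0 < cross y (b - z) / cross (a - z) (b - z) → cross (a - z) y = 0 → C ∈ nhds y := by
    intro a b y hT hR h1 h0
    obtain ⟨h, hr⟩ := hR
    obtain ⟨c, hc, hneg⟩ := exists_opposite_triangle hΩ hT (hfr _ hr)
    refine Filter.mem_of_superset (cone_union_cone_mem_nhds hneg h1 h0) ?_
    rintro x (hx | hx)
    · exact hCmem.2 ⟨a, b, hT, ⟨h, hr⟩, hx⟩
    · exact hCmem.2 ⟨a, c, hc, ⟨h, hr⟩, hx⟩
  have hCnhds : ∀ y ∈ C, y ≠ 0 → C ∈ nhds y := by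
    intro y hy hy0
    obtain ⟨a, b, hT, hR, hcone⟩ := hCmem.1 hy
    have hD := isTriangle_insert hT
    rcases hcone.1.eq_or_lt with h1 | h1 <;> rcases hcone.2.eq_or_lt with h2 | h2
    · have := eq_combination hD y
      rw [← h1, ← h2, zero_smul, zero_smul, add_zero] at this
      exact absurd this hy0
    · have hT' := hT
      rw [insert_swap] at hT'
      refine hray hT' (hRswap hT hR) ?_ ?_
      · rw [cross_comm, cross_comm (b - z), neg_div_neg_eq]; exact h2
      · rw [cross_comm, neg_eq_zero]
        exact (div_eq_zero_iff.1 h1.symm).resolve_right hD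
    · exact hray hT hR h1 ((div_eq_zero_iff.1 h2.symm).resolve_right hD)
    · filter_upwards [(((continuous_cross_left (b - z)).div_const _).isOpen_preimage _
          isOpen_Ioi).mem_nhds h1,
        (((continuous_cross_right (a - z)).div_const _).isOpen_preimage _
          isOpen_Ioi).mem_nhds h2] with x hx hx'
      exact hCmem.2 ⟨a, b, hT, hR, le_of_lt (α := ℝ) hx, le_of_lt (α := ℝ) hx'⟩
  have hopen : IsOpen (C ∩ {0}ᶜ) := by
    rw [isOpen_iff_mem_nhds]
    rintro y ⟨hy, hy0⟩
    exact Filter.inter_mem (hCnhds y hy hy0) (isOpen_compl_singleton.mem_nhds hy0)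
  have hconn : IsPreconnected ({0}ᶜ : Set Plane) :=
    (isConnected_compl_singleton_of_one_lt_rank (by
      rw [← Module.finrank_eq_rank, finrank_euclideanSpace_fin]; norm_num) 0).isPreconnected
  obtain ⟨heE, hez⟩ := 𝒯.mem_edgesAt.1 e.2
  obtain ⟨heE', hez'⟩ := 𝒯.mem_edgesAt.1 e'.2
  have hnonempty : (({0}ᶜ : Set Plane) ∩ (C ∩ {0}ᶜ)).Nonempty := by
    obtain ⟨a, haz, hea⟩ := exists_eq_pair (𝒯.mem_edges.1 heE).2 hez
    obtain ⟨T, hT, heT⟩ := exists_triangle_of_edge heE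
    obtain ⟨hsub, -⟩ := Finset.mem_powersetCard.1 heT
    rw [hea] at hsub
    obtain ⟨b, hTeq⟩ := exists_eq_triple (isTriangle hT).card_eq haz hsub
    rw [hTeq] at hT
    have hRa : R a := ⟨hea ▸ e.2, by
      have : (⟨{z, a}, hea ▸ e.2⟩ : 𝒯.edgesAt z) = e := Subtype.ext hea.symm
      rw [this]⟩
    have haz0 : a - z ≠ 0 := sub_ne_zero.2 haz
    refine ⟨a - z, haz0, hCmem.2 ⟨a, b, hT, hRa, ?_, ?_⟩, haz0⟩
    · rw [div_self (isTriangle_insert hT)]; exact zero_le_one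
    · simp
  have hall : ({0}ᶜ : Set Plane) ⊆ C ∩ {0}ᶜ :=
    hconn.subset_of_closure_inter_subset hopen hnonempty fun y hy =>
      ⟨hCcl.closure_subset (closure_mono Set.inter_subset_left hy.1), hy.2⟩
  obtain ⟨a', haz', hea'⟩ := exists_eq_pair (𝒯.mem_edges.1 heE').2 hez'
  have haz0 : a' - z ≠ 0 := sub_ne_zero.2 haz'
  obtain ⟨a, b, hT, hR, hcone⟩ := hCmem.1 (hall (show a' - z ∈ ({0}ᶜ : Set Plane) from haz0)).1
  have hcomb := eq_combination (isTriangle_insert hT) (a' - z)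
  obtain ⟨hα, hβ⟩ := hcone
  set α := cross (a' - z) (b - z) / cross (a - z) (b - z)
  set β := cross (a - z) (a' - z) / cross (a - z) (b - z)
  -- a point of the edge `e'` that lies in the triangle
  have ht : 0 < (1 + α + β)⁻¹ := by positivity
  set t := (1 + α + β)⁻¹ with htdef
  have ht1 : t * (1 + α + β) = 1 := inv_mul_cancel₀ (by positivity)
  have hxT : z + t • (a' - z) ∈ hull {z, a, b} := by
    refine mem_hull_triple.2 ⟨t * α, t * β, by positivity, by positivity, by nlinarith, ?_⟩
    rw [hcomb, smul_add, smul_smul, smul_smul, add_assoc]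
  have hxe : z + t • (a' - z) ∈ hull {z, a'} :=
    mem_hull_pair.2 ⟨t, ht.le, by nlinarith [mul_nonneg ht.le hα, mul_nonneg ht.le hβ], rfl⟩
  have hxi := hull_inter_subset (𝒯.mem_triangles.1 hT).1 (𝒯.mem_edges.1 (hea' ▸ heE')).1 hxT hxe
  have ha'T : a' ∈ ({z, a, b} : Finset Plane) := by
    by_contra hn
    have hsub : ({z, a, b} ∩ {z, a'} : Finset Plane) ⊆ {z} := by
      intro y hy
      obtain ⟨hy1, hy2⟩ := Finset.mem_inter.1 hy
      simp only [Finset.mem_insert, Finset.mem_singleton] at hy2 ⊢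
      rcases hy2 with rfl | rfl
      · rfl
      · exact absurd hy1 hn
    have hxy : z + t • (a' - z) ∈ hull {z} := convexHull_mono (by exact_mod_cast hsub) hxi
    have hxy' : z + t • (a' - z) = z := by simpa [hull] using hxy
    rw [add_eq_left, smul_eq_zero] at hxy'
    exact hxy'.elim ht.ne' haz0
  have hRa' : R a' := by
    simp only [Finset.mem_insert, Finset.mem_singleton] at ha'T
    rcases ha'T with rfl | rfl | rfl
    · exact absurd rfl haz'
    · exact hR
    · exact hRswap hT hR
  obtain ⟨h, hr⟩ := hRa'
  have : (⟨{z, a'}, h⟩ : 𝒯.edgesAt z) = e' := Subtype.ext hea'.symm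
  exact hne (this ▸ hr)

theorem abs_sub_le_of_reachable {V : Type*} [Fintype V] {G : SimpleGraph V} {f : V → ℝ} {δ : ℝ}
    (hδ : 0 ≤ δ) (hf : ∀ u v, G.Adj u v → |f u - f v| ≤ δ) {u v : V} (h : G.Reachable u v) :
    |f u - f v| ≤ Fintype.card V * δ := by
  have hwalk : ∀ {u v : V} (p : G.Walk u v), |f u - f v| ≤ p.length * δ := by
    intro u v p
    induction p with
    | nil => simp
    | @cons u v w hadj p ih =>
      have h1 := abs_sub_le (f u) (f v) (f w)
      have h2 := hf u v hadj
      rw [SimpleGraph.Walk.length_cons]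
      push_cast
      linarith
  obtain ⟨p, hp⟩ := h.exists_isPath
  refine (hwalk p).trans (mul_le_mul_of_nonneg_right ?_ hδ)
  exact_mod_cast hp.length_lt.le

/-- Values at the edges of a fan that vary by at most `δ` within each triangle and vanish on the
frontier of `Ω` vary by at most a multiple of `δ`. -/
theorem abs_sub_le_fan (hΩ : IsOpen Ω) {z : Plane} {f : Finset Plane → ℝ} {δ : ℝ} (hδ : 0 ≤ δ)
    (hf : ∀ T ∈ 𝒯.trianglesAt z, ∀ e ∈ triangleEdges T, ∀ e' ∈ triangleEdges T, z ∈ e → z ∈ e' →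
      |f e - f e'| ≤ δ)
    (hzero : ∀ e ∈ 𝒯.edgesAt z, hull e ⊆ frontier Ω → f e = 0) {e e' : Finset Plane}
    (he : e ∈ 𝒯.edgesAt z) (he' : e' ∈ 𝒯.edgesAt z) :
    |f e - f e'| ≤ 2 * ((𝒯.edgesAt z).card * δ) := by
  have hadj : ∀ u v : 𝒯.edgesAt z, (𝒯.fanGraph z).Adj u v → |f u.1 - f v.1| ≤ δ := by
    rintro ⟨u, hu⟩ ⟨v, hv⟩ ⟨-, T, hT, huT, hvT⟩
    obtain ⟨hu, hzu⟩ := 𝒯.mem_edgesAt.1 hu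
    obtain ⟨hv, hzv⟩ := 𝒯.mem_edgesAt.1 hv
    exact hf T (mem_trianglesAt.2 ⟨hT, huT hzu⟩) u
      (Finset.mem_powersetCard.2 ⟨huT, (𝒯.mem_edges.1 hu).2⟩) v
      (Finset.mem_powersetCard.2 ⟨hvT, (𝒯.mem_edges.1 hv).2⟩) hzu hzv
  have hreach : ∀ {u v : 𝒯.edgesAt z}, (𝒯.fanGraph z).Reachable u v →
      |f u.1 - f v.1| ≤ (𝒯.edgesAt z).card * δ := by
    intro u v h
    have := abs_sub_le_of_reachable (f := fun w : 𝒯.edgesAt z => f w.1) hδ hadj h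
    rwa [Fintype.card_coe] at this
  have hnn : 0 ≤ (𝒯.edgesAt z).card * δ := by positivity
  rcases reachable_or_exists_frontier hΩ (⟨e, he⟩ : 𝒯.edgesAt z) ⟨e', he'⟩ with h | ⟨u, hu, hu0⟩
  · have := hreach h
    linarith
  rcases reachable_or_exists_frontier hΩ (⟨e', he'⟩ : 𝒯.edgesAt z) ⟨e, he⟩ with h | ⟨v, hv, hv0⟩
  · have := hreach h
    rw [abs_sub_comm]
    linarith
  · have h1 := hreach hu
    have h2 := hreach hv
    rw [hzero _ u.2 hu0, sub_zero] at h1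
    rw [hzero _ v.2 hv0, sub_zero] at h2
    have h3 := abs_sub (f e) (f e')
    linarith

end Triangulation

/-! ### Stability of the averaging operator -/

theorem interpolant_apply {T : Finset Plane} (hT : IsTriangle T) (g : Plane → ℝ) {z : Plane}
    (hz : z ∈ T) : interpolant T g z = g z := by
  have h := exists_interpolant hT.card_eq hT.indep g
  rw [interpolant, dif_pos h]
  exact h.choose_spec z hz

theorem abs_sum_div_card_sub_le {ι : Type*} {s : Finset ι} (hs : s.Nonempty) {f : ι → ℝ} {c δ : ℝ}
    (h : ∀ i ∈ s, |f i - c| ≤ δ) : |(∑ i ∈ s, f i) / (s.card : ℝ) - c| ≤ δ := by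
  have hpos : (0 : ℝ) < s.card := by exact_mod_cast Finset.card_pos.2 hs
  have e : (∑ i ∈ s, f i) / (s.card : ℝ) - c = (∑ i ∈ s, (f i - c)) / s.card := by
    rw [Finset.sum_sub_distrib, Finset.sum_const, nsmul_eq_mul]
    field_simp
  rw [e, abs_div, abs_of_pos hpos, div_le_iff₀ hpos, mul_comm, ← nsmul_eq_mul]
  exact (Finset.abs_sum_le_sum_abs _ _).trans (Finset.sum_le_card_nsmul _ _ _ h)

namespace Triangulation

variable {Ω : Set Plane} {𝒯 : Triangulation Ω}

theorem traceSpace_triangle {μ : Finset Plane → Plane → ℝ} (hμ : μ ∈ traceSpace 𝒯)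
    {T : Finset Plane} (hT : T ∈ 𝒯.triangles) :
    ∀ e ∈ triangleEdges T, ∃ p : ScalarP1, ∀ x ∈ hull e, μ e x = p x :=
  fun e he => hμ e (mem_edges_of_triangle hT he)

theorem exists_traceSpace_rep {μ : Finset Plane → Plane → ℝ} (hμ : μ ∈ traceSpace 𝒯) :
    ∃ p : Finset Plane → ScalarP1, ∀ e ∈ 𝒯.edges, ∀ x ∈ hull e, μ e x = p e x := by
  have : ∀ e, ∃ p : ScalarP1, e ∈ 𝒯.edges → ∀ x ∈ hull e, μ e x = p x := by
    intro e
    by_cases he : e ∈ 𝒯.edges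
    · obtain ⟨p, hp⟩ := hμ e he
      exact ⟨p, fun _ => hp⟩
    · exact ⟨0, fun h => absurd h he⟩
  choose p hp using this
  exact ⟨p, hp⟩

theorem mem_hull_of_mem {s : Finset Plane} {z : Plane} (hz : z ∈ s) : z ∈ hull s :=
  subset_convexHull ℝ _ hz

theorem abs_jump_le {μ : Finset Plane → Plane → ℝ} (hμ : μ ∈ traceSpace 𝒯) {σ : ℝ}
    (hσ : 𝒯.ShapeRegular σ) {T : Finset Plane} (hT : T ∈ 𝒯.triangles) {τ : ℝ} (hτ : 0 < τ)
    {e e' : Finset Plane} (he : e ∈ triangleEdges T) (he' : e' ∈ triangleEdges T) {z : Plane}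
    (hz : z ∈ e) (hz' : z ∈ e') :
    |μ e z - μ e' z| ≤ √(16 * σ ^ 2 * fluxEnergy τ T μ) := by
  obtain ⟨p, hp⟩ := exists_traceSpace_rep hμ
  by_cases hee : e = e'
  · rw [hee, sub_self, abs_zero]; exact Real.sqrt_nonneg _
  have hpT : ∀ f ∈ triangleEdges T, ∀ x ∈ hull f, μ f x = p f x :=
    fun f hf => hp f (mem_edges_of_triangle hT hf)
  rw [hpT e he z (mem_hull_of_mem hz), hpT e' he' z (mem_hull_of_mem hz')]
  obtain ⟨hs, hc⟩ := Finset.mem_powersetCard.1 he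
  obtain ⟨hs', hc'⟩ := Finset.mem_powersetCard.1 he'
  obtain ⟨a, haz, rfl⟩ := exists_eq_pair hc hz
  obtain ⟨b, hbz, rfl⟩ := exists_eq_pair hc' hz'
  have hab : a ≠ b := by rintro rfl; exact hee rfl
  have hTeq : {z, a, b} = T := by
    refine Finset.eq_of_subset_of_card_le ?_ ?_
    · intro y hy
      simp only [Finset.mem_insert, Finset.mem_singleton] at hy
      rcases hy with rfl | rfl | rfl
      · exact hs (by simp)
      · exact hs (by simp)
      · exact hs' (by simp)
    · rw [(isTriangle hT).card_eq, Finset.card_eq_three.2 ⟨z, a, b, haz.symm, hbz.symm, hab, rfl⟩]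
  subst hTeq
  exact abs_jump_le_sqrt_fluxEnergy (isTriangle hT) hτ (hσ _ hT) hpT

theorem abs_variation_le {μ : Finset Plane → Plane → ℝ} (hμ : μ ∈ traceSpace 𝒯) {σ : ℝ}
    (hσ : 𝒯.ShapeRegular σ) {T : Finset Plane} (hT : T ∈ 𝒯.triangles) {τ : ℝ} (hτ : 0 < τ)
    {z a : Plane} (haz : a ≠ z) (hsub : {z, a} ⊆ T) :
    |μ {z, a} z - μ {z, a} a| ≤ 4 * √(16 * σ ^ 2 * fluxEnergy τ T μ) := by
  obtain ⟨p, hp⟩ := exists_traceSpace_rep hμ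
  have hpT : ∀ f ∈ triangleEdges T, ∀ x ∈ hull f, μ f x = p f x :=
    fun f hf => hp f (mem_edges_of_triangle hT hf)
  have he : {z, a} ∈ triangleEdges T := Finset.mem_powersetCard.2 ⟨hsub, Finset.card_pair haz.symm⟩
  rw [hpT _ he z (mem_hull_of_mem (by simp)), hpT _ he a (mem_hull_of_mem (by simp))]
  obtain ⟨b, rfl⟩ := exists_eq_triple (isTriangle hT).card_eq haz hsub
  exact abs_variation_le_sqrt_fluxEnergy (isTriangle hT) hτ (hσ _ hT) hpT

/-- The sum of a quantity over the triangles that touch the triangle `T`, counted once for each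
common vertex. -/
noncomputable def patchSum (𝒯 : Triangulation Ω) (E : Finset Plane → ℝ) (T : Finset Plane) : ℝ :=
  ∑ z ∈ T, ∑ T' ∈ 𝒯.trianglesAt z, E T'

theorem sum_patchSum_le {σ ρ : ℝ} (hσ : 𝒯.ShapeRegular σ) (hρ : 𝒯.QuasiUniform ρ)
    {E : Finset Plane → ℝ} (hE : ∀ T, 0 ≤ E T) :
    ∑ T ∈ 𝒯.triangles, 𝒯.patchSum E T ≤ 12 * σ ^ 2 * ρ ^ 2 * ∑ T ∈ 𝒯.triangles, E T := by
  classical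
  have h1 : ∀ T ∈ 𝒯.triangles, 𝒯.patchSum E T
      = ∑ T' ∈ 𝒯.triangles, ∑ z ∈ T' ∩ T, E T' := by
    intro T _
    refine Finset.sum_comm' fun z T' => ?_
    rw [mem_trianglesAt, Finset.mem_inter]
    tauto
  have h2 : ∀ T' ∈ 𝒯.triangles, ∑ T ∈ 𝒯.triangles, ∑ z ∈ T' ∩ T, E T'
      = ∑ z ∈ T', ∑ _T ∈ 𝒯.trianglesAt z, E T' := by
    intro T' _
    refine Finset.sum_comm' fun T z => ?_
    rw [mem_trianglesAt, Finset.mem_inter]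
    tauto
  rw [Finset.sum_congr rfl h1, Finset.sum_comm, Finset.sum_congr rfl h2, Finset.mul_sum]
  refine Finset.sum_le_sum fun T hT => ?_
  simp only [Finset.sum_const, nsmul_eq_mul]
  refine (Finset.sum_le_card_nsmul T _ (4 * σ ^ 2 * ρ ^ 2 * E T) fun z _ =>
    mul_le_mul_of_nonneg_right (card_trianglesAt_le hσ hρ z) (hE T)).trans (le_of_eq ?_)
  rw [(isTriangle hT).card_eq, nsmul_eq_mul]
  push_cast
  ring

/-- The vertex averages vary on a triangle by at most the fluxes on the surrounding triangles. -/
theorem abs_vertexAverage_sub_le (hΩ : IsOpen Ω) {σ ρ : ℝ} (hσ : 𝒯.ShapeRegular σ)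
    (hρ : 𝒯.QuasiUniform ρ) {τ : Finset Plane → ℝ} (hτ : ∀ T ∈ 𝒯.triangles, 0 < τ T)
    {μ : Finset Plane → Plane → ℝ} (hμ : μ ∈ traceSpaceZero 𝒯) {T : Finset Plane}
    (hT : T ∈ 𝒯.triangles) {z a : Plane} (hz : z ∈ T) (ha : a ∈ T) :
    |vertexAverage 𝒯 μ z - vertexAverage 𝒯 μ a| ≤ (48 * σ ^ 2 * ρ ^ 2 + 4) *
      √(16 * σ ^ 2 * 𝒯.patchSum (fun T' => fluxEnergy (τ T') T' μ) T) := by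
  set E : Finset Plane → ℝ := fun T' => fluxEnergy (τ T') T' μ with hE
  have hEnn : ∀ T', 0 ≤ E T' := fun T' => fluxEnergy_nonneg _ _ _
  set η := √(16 * σ ^ 2 * 𝒯.patchSum E T) with hη
  have hηnn : 0 ≤ η := Real.sqrt_nonneg _
  by_cases haz : a = z
  · rw [haz, sub_self, abs_zero]; positivity
  -- `η` dominates the local bound on each triangle that touches `T`
  have hdom : ∀ y ∈ T, ∀ T' ∈ 𝒯.trianglesAt y, √(16 * σ ^ 2 * E T') ≤ η := by
    intro y hy T' hT'
    refine Real.sqrt_le_sqrt (mul_le_mul_of_nonneg_left ?_ (by positivity))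
    refine (Finset.single_le_sum (f := E) (fun T _ => hEnn T) hT').trans ?_
    exact Finset.single_le_sum (f := fun z => ∑ T' ∈ 𝒯.trianglesAt z, E T')
      (fun z _ => Finset.sum_nonneg fun T _ => hEnn T) hy
  have hvert : ∀ y ∈ T, ∀ e ∈ 𝒯.edgesAt y,
      |vertexAverage 𝒯 μ y - μ e y| ≤ 24 * σ ^ 2 * ρ ^ 2 * η := by
    intro y hy e he
    refine abs_sum_div_card_sub_le ⟨e, he⟩ fun e' he' => ?_
    refine (abs_sub_le_fan (f := fun e => μ e y) hΩ hηnn (fun T' hT' f hf f' hf' hyf hyf' => ?_)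
      (fun f hf hfr => ?_) he' he).trans ?_
    · exact (abs_jump_le hμ.1 hσ (mem_trianglesAt.1 hT').1 (hτ T' (mem_trianglesAt.1 hT').1)
        hf hf' hyf hyf').trans (hdom y hy T' hT')
    · obtain ⟨hf, hyf⟩ := 𝒯.mem_edgesAt.1 hf
      exact hμ.2 f hf hfr y (mem_hull_of_mem hyf)
    · have := mul_le_mul_of_nonneg_right (card_edgesAt_le hσ hρ y) hηnn
      linarith
  have hsub : {z, a} ⊆ T := by
    intro y hy
    simp only [Finset.mem_insert, Finset.mem_singleton] at hy
    rcases hy with rfl | rfl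
    · exact hz
    · exact ha
  have he : {z, a} ∈ 𝒯.edges := mem_edges_of_triangle hT
    (Finset.mem_powersetCard.2 ⟨hsub, Finset.card_pair (Ne.symm haz)⟩)
  have h1 := hvert z hz _ (𝒯.mem_edgesAt.2 ⟨he, by simp⟩)
  have h2 := hvert a ha _ (𝒯.mem_edgesAt.2 ⟨he, by simp⟩)
  have h3 := (abs_variation_le hμ.1 hσ hT (hτ T hT) haz hsub).trans
    (mul_le_mul_of_nonneg_left (hdom z hz T (mem_trianglesAt.2 ⟨hT, hz⟩)) (by norm_num))
  rw [abs_le] at *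
  constructor <;> linarith [h1.1, h1.2, h2.1, h2.2, h3.1, h3.2]

/-- The Dirichlet energy of the averaged function is bounded by the fluxes. -/
theorem sum_dirichlet_le (hΩ : IsOpen Ω) {σ ρ : ℝ} (hσ : 𝒯.ShapeRegular σ)
    (hρ : 𝒯.QuasiUniform ρ) {τ : Finset Plane → ℝ} (hτ : ∀ T ∈ 𝒯.triangles, 0 < τ T)
    {μ : Finset Plane → Plane → ℝ} (hμ : μ ∈ traceSpaceZero 𝒯) :
    ∑ T ∈ 𝒯.triangles,
        ‖grad (interpolant T (vertexAverage 𝒯 μ))‖ ^ 2 * volume.real (hull T)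
      ≤ Real.pi * σ ^ 2 * (48 * σ ^ 2 * ρ ^ 2 + 4) ^ 2 * (16 * σ ^ 2) * (12 * σ ^ 2 * ρ ^ 2)
        * ∑ T ∈ 𝒯.triangles, fluxEnergy (τ T) T μ := by
  set E : Finset Plane → ℝ := fun T' => fluxEnergy (τ T') T' μ with hE
  have hEnn : ∀ T', 0 ≤ E T' := fun T' => fluxEnergy_nonneg _ _ _
  have hloc : ∀ T ∈ 𝒯.triangles,
      ‖grad (interpolant T (vertexAverage 𝒯 μ))‖ ^ 2 * volume.real (hull T)
        ≤ Real.pi * σ ^ 2 * (48 * σ ^ 2 * ρ ^ 2 + 4) ^ 2 * (16 * σ ^ 2) * 𝒯.patchSum E T := by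
    intro T hT
    have hTri := isTriangle hT
    have hnn : 0 ≤ 16 * σ ^ 2 * 𝒯.patchSum E T :=
      mul_nonneg (by positivity) (Finset.sum_nonneg fun z _ => Finset.sum_nonneg fun T _ => hEnn T)
    refine (sq_norm_grad_mul_volume_le (Finset.card_pos.1 (by rw [hTri.card_eq]; norm_num))
      (hσ T hT) (δ := (48 * σ ^ 2 * ρ ^ 2 + 4) * √(16 * σ ^ 2 * 𝒯.patchSum E T))
      fun z hz a ha => ?_).trans (le_of_eq ?_)
    · rw [interpolant_apply hTri _ hz, interpolant_apply hTri _ ha]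
      exact abs_vertexAverage_sub_le hΩ hσ hρ hτ hμ hT hz ha
    · rw [mul_pow, Real.sq_sqrt hnn]; ring
  refine (Finset.sum_le_sum hloc).trans ?_
  rw [← Finset.mul_sum, mul_assoc _ (12 * σ ^ 2 * ρ ^ 2)]
  exact mul_le_mul_of_nonneg_left (sum_patchSum_le hσ hρ hEnn)
    (by have := Real.pi_pos; positivity)

theorem sum_fluxEnergy_le_energyForm {τ : Finset Plane → ℝ} (hτ : ∀ T ∈ 𝒯.triangles, 0 < τ T)
    (μ : Finset Plane → Plane → ℝ) :
    ∑ T ∈ 𝒯.triangles, fluxEnergy (τ T) T μ ≤ energyForm 𝒯 τ μ μ :=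
  Finset.sum_le_sum fun T hT => le_add_of_nonneg_right
    (mul_nonneg (hτ T hT).le (boundaryIntegral_nonneg T fun _ _ => mul_self_nonneg _))

theorem energyForm_self_nonneg {τ : Finset Plane → ℝ} (hτ : ∀ T ∈ 𝒯.triangles, 0 < τ T)
    (μ : Finset Plane → Plane → ℝ) : 0 ≤ energyForm 𝒯 τ μ μ :=
  (Finset.sum_nonneg fun _ _ => fluxEnergy_nonneg _ _ _).trans (sum_fluxEnergy_le_energyForm hτ μ)

/-- The energy of the trace of a continuous function that is affine on the triangles of a coarser
mesh is at most the Dirichlet energy of the function. -/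
theorem energyForm_le_dirichlet {𝒯' : Triangulation Ω} (href : 𝒯'.IsRefinement 𝒯)
    {τ : Finset Plane → ℝ} (hτ : ∀ T ∈ 𝒯'.triangles, 0 < τ T) {m : Plane → ℝ}
    {u : Finset Plane → ScalarP1} (hm : ∀ T ∈ 𝒯.triangles, ∀ x ∈ hull T, m x = u T x) :
    energyForm 𝒯' τ (fun _ => m) (fun _ => m)
      ≤ ∑ T ∈ 𝒯.triangles, ‖grad (u T)‖ ^ 2 * volume.real (hull T) := by
  classical
  have : ∀ T', ∃ T, T' ∈ 𝒯'.triangles → T ∈ 𝒯.triangles ∧ hull T' ⊆ hull T := by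
    intro T'
    by_cases h : T' ∈ 𝒯'.triangles
    · obtain ⟨T, hT, hs⟩ := href T' h
      exact ⟨T, fun _ => ⟨hT, hs⟩⟩
    · exact ⟨∅, fun h' => absurd h' h⟩
  choose φ hφ using this
  have hterm : ∀ T' ∈ 𝒯'.triangles,
      triangleIntegral T' (fun x => ⟪(localSolution (τ T') T' (fun _ => m)).1 x,
          (localSolution (τ T') T' (fun _ => m)).1 x⟫)
        + τ T' * boundaryIntegral T' (fun _ x =>
          ((localSolution (τ T') T' (fun _ => m)).2 x - m x)
            * ((localSolution (τ T') T' (fun _ => m)).2 x - m x))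
      = ‖grad (u (φ T'))‖ ^ 2 * volume.real (hull T') := by
    intro T' hT'
    obtain ⟨hT, hs⟩ := hφ T' hT'
    have hedge : ∀ e ∈ triangleEdges T', ∀ x ∈ hull e, m x = u (φ T') x := fun e he x hx =>
      hm _ hT x (hs (convexHull_mono (by exact_mod_cast (Finset.mem_powersetCard.1 he).1) hx))
    rw [localSolution_affine (isTriangle hT') (hτ T' hT') hedge,
      boundaryIntegral_congr (g := fun _ _ => 0) (fun e he x hx => by
        rw [hedge e he x hx, sub_self, mul_zero])]
    simp [triangleIntegral, boundaryIntegral, edgeIntegral, mul_comm]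
  rw [energyForm, Finset.sum_congr rfl hterm,
    ← Finset.sum_fiberwise_of_maps_to (fun T' hT' => (hφ T' hT').1)]
  refine Finset.sum_le_sum fun T hT => ?_
  have e : ∀ T' ∈ 𝒯'.triangles.filter (fun T' => φ T' = T),
      ‖grad (u (φ T'))‖ ^ 2 * volume.real (hull T')
        = ‖grad (u T)‖ ^ 2 * volume.real (hull T') := by
    intro T' hT'
    rw [(Finset.mem_filter.1 hT').2]
  rw [Finset.sum_congr rfl e, ← Finset.mul_sum]
  refine mul_le_mul_of_nonneg_left (sum_volume_le (Finset.filter_subset _ _) (fun T' hT' => ?_)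
    (volume_hull_ne_top T)) (sq_nonneg _)
  obtain ⟨h1, rfl⟩ := Finset.mem_filter.1 hT'
  exact (hφ T' h1).2

theorem isRefinement_of_le {L : ℕ} {𝒯 : Fin (L + 1) → Triangulation Ω}
    (href : ∀ i : Fin L, (𝒯 i.succ).IsRefinement (𝒯 i.castSucc)) {l k : Fin (L + 1)} (h : l ≤ k) :
    (𝒯 k).IsRefinement (𝒯 l) := by
  induction k using Fin.induction with
  | zero =>
    obtain rfl : l = 0 := Fin.le_zero_iff.1 h
    exact fun T hT => ⟨T, hT, le_rfl⟩
  | succ i ih =>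
    rcases h.eq_or_lt with rfl | hlt
    · exact fun T hT => ⟨T, hT, le_rfl⟩
    · intro T hT
      obtain ⟨T₁, hT₁, hs₁⟩ := href i T hT
      obtain ⟨T₂, hT₂, hs₂⟩ := ih (Fin.le_castSucc_iff.2 hlt) T₁ hT₁
      exact ⟨T₂, hT₂, hs₁.trans hs₂⟩

/-- A function that is affine on the triangles of a coarser mesh has an affine trace on each edge of
the finer one. -/
theorem const_mem_traceSpace {𝒯' : Triangulation Ω} (href : 𝒯'.IsRefinement 𝒯) {m : Plane → ℝ}
    {u : Finset Plane → ScalarP1} (hm : ∀ T ∈ 𝒯.triangles, ∀ x ∈ hull T, m x = u T x) :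
    (fun _ => m) ∈ traceSpace 𝒯' := by
  intro e he
  obtain ⟨T', hT', heT⟩ := exists_triangle_of_edge he
  obtain ⟨T, hT, hs⟩ := href T' hT'
  exact ⟨u T, fun x hx =>
    hm T hT x (hs (convexHull_mono (by exact_mod_cast (Finset.mem_powersetCard.1 heT).1) hx))⟩

end Triangulation

end HDG

theorem mainTheorem1 (σ ρ cτ : ℝ) :
    ∃ C : ℝ, 0 < C ∧
      ∀ (Ω : Set HDG.Plane), IsOpen Ω → IsConnected Ω →
      ∀ (L : ℕ) (𝒯 : Fin (L + 1) → HDG.Triangulation Ω)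
        (τ : Fin (L + 1) → Finset HDG.Plane → ℝ),
        (∀ l, (𝒯 l).ShapeRegular σ) →
        (∀ l, (𝒯 l).QuasiUniform ρ) →
        (∀ i : Fin L, (𝒯 i.succ).IsRefinement (𝒯 i.castSucc)) →
        (∀ l, ∀ T ∈ (𝒯 l).triangles, 0 < τ l T ∧ τ l T ≤ cτ / (𝒯 l).meshSize) →
        (∀ l, ∀ μ ∈ HDG.traceSpace (𝒯 l), ∀ T ∈ (𝒯 l).triangles,
          ∃! s, HDG.IsLocalSolution (τ l T) T μ s) ∧
        (∀ l, ∀ μ ∈ HDG.traceSpace (𝒯 l),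
          HDG.transfer 𝒯 l μ ∈ HDG.traceSpace (𝒯 (Fin.last L))) ∧
        (∀ l, ∀ μ ∈ HDG.traceSpaceZero (𝒯 l),
          HDG.energyForm (𝒯 (Fin.last L)) (τ (Fin.last L))
              (HDG.transfer 𝒯 l μ) (HDG.transfer 𝒯 l μ)
            ≤ C * HDG.energyForm (𝒯 l) (τ l) μ μ) := by
  set K := Real.pi * σ ^ 2 * (48 * σ ^ 2 * ρ ^ 2 + 4) ^ 2 * (16 * σ ^ 2) * (12 * σ ^ 2 * ρ ^ 2)
    with hK
  have hKnn : 0 ≤ K := by have := Real.pi_pos; positivity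
  refine ⟨1 + K, by linarith, ?_⟩
  intro Ω hΩ _ L 𝒯 τ hσ hρ href hτ
  have hτ' : ∀ l, ∀ T ∈ (𝒯 l).triangles, 0 < τ l T := fun l T hT => (hτ l T hT).1
  refine ⟨fun l μ hμ T hT => ?_, fun l μ hμ => ?_, fun l μ hμ => ?_⟩
  · exact HDG.existsUnique_isLocalSolution (HDG.Triangulation.isTriangle hT) (hτ' l T hT)
      (HDG.Triangulation.traceSpace_triangle hμ hT)
  · by_cases hl : l = Fin.last L
    · subst hl
      rw [HDG.transfer, if_pos rfl]
      exact hμ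
    · rw [HDG.transfer, if_neg hl]
      exact HDG.Triangulation.const_mem_traceSpace
        (HDG.Triangulation.isRefinement_of_le href (Fin.le_last l))
        fun T hT x hx => HDG.averageInterpolant_eq (𝒯 l) μ hT hx
  · have hnn := HDG.Triangulation.energyForm_self_nonneg (hτ' l) μ
    by_cases hl : l = Fin.last L
    · subst hl
      rw [HDG.transfer, if_pos rfl]
      nlinarith
    · rw [HDG.transfer, if_neg hl]
      have h1 := HDG.Triangulation.energyForm_le_dirichlet
        (HDG.Triangulation.isRefinement_of_le href (Fin.le_last l))
        (hτ' (Fin.last L)) (fun T hT x hx => HDG.averageInterpolant_eq (𝒯 l) μ hT hx)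
      have h2 := HDG.Triangulation.sum_dirichlet_le hΩ (hσ l) (hρ l) (hτ' l) hμ
      have h3 := mul_le_mul_of_nonneg_left
        (HDG.Triangulation.sum_fluxEnergy_le_energyForm (hτ' l) μ) hKnn
      linarith
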